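/- **Setting.** Let $\mathcal G=(\mathcal N,\mathcal E)$ be a connected undirected graph with $N=|\mathcal N|\ge 2$ nodes, degrees $d_i$ and Laplacian $\Omega$. For each node $i$ let $F_i=\rho_i+\gamma_i$ on $\mathbb R^n$, where $\gamma_i$ is convex, bounded below and differentiable with $L_{\gamma_i}$-Lipschitz gradient, and $\rho_i$ is convex with $\tau_i\|x\|_2\le\rho_i(x)$ for all $x$ (for some $\tau_i>0$) and with a uniformly bounded subdifferential. Let $F^*=\min_{x\in\mathbb R^n}\sum_iF_i(x)$. Call $\mathbf x=(x_i)_{i\in\mathcal N}\in\mathbb R^{nN}$ *$\epsilon$-optimal* if $|\sum_iF_i(x_i)-F^*|\le\epsilon$ and *$\epsilon$-feasible* if $\|x_i-x_j\|_2\le\epsilon$ for all $(i,j)\in\mathcal E$. Let $A$ be a real matrix with $A^{\mathsf T}A=\Omega\otimes I_n$. **DFAL.** Let $c\in(0,1)$ and $\lambda^{(1)},\alpha^{(1)},\xi^{(1)}>0$ with $\xi^{(1)}/\lambda^{(1)}<\min_i\tau_i$, and set $\lambda^{(k+1)}=c\lambda^{(k)}$, $\alpha^{(k+1)}=c^2\alpha^{(k)}$,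 $\xi^{(k+1)}=c^2\xi^{(k)}$, $\theta^{(1)}=0$, $\theta^{(k+1)}=\theta^{(k)}-A\mathbf x^{(k)}/\lambda^{(k)}$. With $$f^{(k)}(\mathbf x)=\lambda^{(k)}\sum_i\gamma_i(x_i)+\tfrac12\|A\mathbf x-\lambda^{(k)}\theta^{(k)}\|_2^2,\qquad P^{(k)}(\mathbf x)=\lambda^{(k)}\sum_i\rho_i(x_i)+f^{(k)}(\mathbf x),$$ the conditions on the $k$-th iterate are: (a) $P^{(k)}(\mathbf x^{(k)})-\min P^{(k)}\le\alpha^{(k)}$; (b) there are $g_i\in\lambda^{(k)}\partial\rho_i(x^{(k)}_i)+\nabla_{x_i}f^{(k)}(\mathbf x^{(k)})$ with $\max_i\|g_i\|_2\le\xi^{(k)}/\sqrt N$. Iteration $k$ is *successful* if (a) or (b) holds. For $\bar C>0$ let $N(\epsilon)=\max\{1,\lceil\log_{1/c}(\bar C/\epsilon)\rceil\}$. A random sequence $(\mathbf x^{(k)})$ is a *run of asynchronous DFAL* (with parameters $\epsilon,p$) if for every $1\le k\le N(\epsilon)$, conditionally on iterations $1,\dots,k-1$ all being successful, iteration $k$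 is successful with probability at least $(1-p)^{1/N(\epsilon)}$. **ARBCD.** To minimize $\sum_ig_i(y_i)+f(\mathbf y)$ with step constants $L_i>0$ from $\mathbf z^{(0)}$, put $\mathbf u^{(0)}=0$, $t^{(0)}=1$. Iteration $\ell\ge0$ draws a node $i$ uniformly, independently of the past, sets $$z_i^{(\ell+1)}=\mathrm{prox}_{t^{(\ell)}g_i/L_i}\Big(z_i^{(\ell)}-\tfrac{t^{(\ell)}}{L_i}\nabla_{y_i}f\big((Nt^{(\ell)})^{-2}\mathbf u^{(\ell)}+\mathbf z^{(\ell)}\big)\Big),\quad u_i^{(\ell+1)}=u_i^{(\ell)}+N^2t^{(\ell)}(1-t^{(\ell)})(z_i^{(\ell+1)}-z_i^{(\ell)}),$$ keeps all other blocks, and sets $t^{(\ell+1)}=\big(1+\sqrt{1+(2Nt^{(\ell)})^2}\big)/(2N)$. The output after $T+1$ iterations is $(Nt^{(T)})^{-2}\mathbf u^{(T+1)}+\mathbf z^{(T+1)}$. **Theorem.** There is $\bar C>0$, not depending on $\epsilon$, $p$ or $\mathbf x^{(0)}$, such that: 1. For all $\epsilon>0$ and $p\in(0,1)$, every run of asynchronous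 DFAL with parameters $\epsilon,p$ satisfies $$\mathbb P\big(\mathbf x^{(N(\epsilon))}\text{ is $\epsilon$-optimal and $\epsilon$-feasible}\big)\ge1-p .$$ 2. For every $\mathbf x^{(0)}$ there are $M,\epsilon_0>0$ such that for all $\epsilon\in(0,\epsilon_0)$ and $p\in(0,1)$ there are integers $K_k,T_k\ge1$ with $$\sum_{k=1}^{N(\epsilon)}K_kT_k\le\frac M\epsilon\Big(\log\frac1p+\log\log\frac1\epsilon\Big)$$ for which the following holds. Let $\mathbf x^{(k)}$ be an output with least value of $P^{(k)}$ among those of $K_k$ independent calls of ARBCD for $\min P^{(k)}$ (with $g_i=\lambda^{(k)}\rho_i$, $f=f^{(k)}$, step constants $\lambda^{(k)}L_{\gamma_i}+d_i$), each started at $\mathbf x^{(k-1)}$ and run for $T_k$ iterations. Then $(\mathbf x^{(k)})$ is a run of asynchronous DFAL with parameters $\epsilon,p$, and $\mathbf x^{(N(\epsilon))}$ is $\epsilon$-optimal and $\epsilon$-feasible with probability at least $1-p$. So $O\big(\epsilon^{-1}(\log\frac1p+\log\log\frac1\epsilon)\big)$ ARBCD iterations in total suffice. -/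

import Mathlib

open MeasureTheory ProbabilityTheory
open scoped NNReal Matrix Kronecker

noncomputable section

namespace AsyncDFAL

/-- A vector of `ℝ^{nN}`, in blocks `x i ∈ ℝⁿ` (Euclidean norm), one block for each node `i`. -/
abbrev Blocks (V : Type*) (n : ℕ) : Type _ := V → EuclideanSpace ℝ (Fin n)

/-! ### Convex-analytic notions -/

/-- The subdifferential `∂ρ(x)` of a finite convex function. -/
def subdiff {n : ℕ} (ρ : EuclideanSpace ℝ (Fin n) → ℝ) (x : EuclideanSpace ℝ (Fin n)) :
    Set (EuclideanSpace ℝ (Fin n)) :=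
  {q | ∀ y, ρ x + inner ℝ q (y - x) ≤ ρ y}

/-- `prox_g(x) = argmin_y { g(y) + ½‖y - x‖² }` (unique for a finite convex `g`). -/
def prox {n : ℕ} (g : EuclideanSpace ℝ (Fin n) → ℝ) (x : EuclideanSpace ℝ (Fin n)) :
    EuclideanSpace ℝ (Fin n) :=
  Classical.epsilon fun z => IsMinOn (fun y => g y + 1 / 2 * ‖y - x‖ ^ 2) Set.univ z

/-- The partial gradient `∇_{x_i} f(x)`: the gradient of `y ↦ f(y; x_{-i})` at `y = x_i`. -/
def blockGrad {V : Type*} [DecidableEq V] {n : ℕ} (f : Blocks V n → ℝ) (i : V)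
    (x : Blocks V n) : EuclideanSpace ℝ (Fin n) :=
  gradient (fun y => f (Function.update x i y)) (x i)

/-- The class `Γ`: convex, bounded below, with an `L`-Lipschitz continuous gradient. -/
structure IsSmoothTerm {n : ℕ} (γ : EuclideanSpace ℝ (Fin n) → ℝ) (L : ℝ≥0) : Prop where
  convex : ConvexOn ℝ Set.univ γ
  differentiable : Differentiable ℝ γ
  lipschitz : LipschitzWith L (gradient γ)
  bddBelow : ∃ m : ℝ, ∀ x, m ≤ γ x

/-- The class `R`: convex, with a uniformly bounded subdifferential, and `ρ ≥ τ‖·‖`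
for the constant `τ > 0`. -/
structure IsNonsmoothTerm {n : ℕ} (ρ : EuclideanSpace ℝ (Fin n) → ℝ) (τ : ℝ) : Prop where
  convex : ConvexOn ℝ Set.univ ρ
  subdiff_bounded : ∃ B : ℝ, 0 < B ∧ ∀ x, ∀ q ∈ subdiff ρ x, ‖q‖ ≤ B
  tau_pos : 0 < τ
  coercive : ∀ x, τ * ‖x‖ ≤ ρ x

/-! ### The accelerated randomized block coordinate descent method (ARBCD) -/

section ARBCD

variable {V : Type*} [Fintype V] [DecidableEq V] {n : ℕ}

/-- The variables `z`, `u`, `t` of ARBCD. -/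
structure ARBCDState (V : Type*) (n : ℕ) where
  z : Blocks V n
  u : Blocks V n
  t : ℝ

/-- The point `(1 / (N t))² u + z`. -/
def extrapolate (t : ℝ) (u z : Blocks V n) : Blocks V n :=
  (1 / ((Fintype.card V : ℝ) * t)) ^ 2 • u + z

/-- One ARBCD iteration for `min ∑ᵢ gᵢ(yᵢ) + f(y)` with step constants `Lip i`,
when node `i` is drawn. -/
def arbcdStep (g : V → EuclideanSpace ℝ (Fin n) → ℝ) (f : Blocks V n → ℝ) (Lip : V → ℝ)
    (i : V) (s : ARBCDState V n) : ARBCDState V n :=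
  let N : ℝ := Fintype.card V
  let zi := prox (fun y => s.t / Lip i * g i y)
    (s.z i - (s.t / Lip i) • blockGrad f i (extrapolate s.t s.u s.z))
  { z := Function.update s.z i zi
    u := Function.update s.u i (s.u i + (N ^ 2 * s.t * (1 - s.t)) • (zi - s.z i))
    t := (1 + √(1 + (2 * N * s.t) ^ 2)) / (2 * N) }

/-- The ARBCD variables after `ℓ` iterations started at `z0`, when node `idx m` is drawn
in iteration `m`. -/
def arbcdState (g : V → EuclideanSpace ℝ (Fin n) → ℝ) (f : Blocks V n → ℝ) (Lip : V → ℝ)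
    (z0 : Blocks V n) (idx : ℕ → V) : ℕ → ARBCDState V n
  | 0 => { z := z0, u := 0, t := 1 }
  | ℓ + 1 => arbcdStep g f Lip (idx ℓ) (arbcdState g f Lip z0 idx ℓ)

/-- The output `(1 / (N t^(T)))² u^(T+1) + z^(T+1)` of a call to ARBCD; it performs
`T + 1` iterations. -/
def arbcdOutput (g : V → EuclideanSpace ℝ (Fin n) → ℝ) (f : Blocks V n → ℝ) (Lip : V → ℝ)
    (z0 : Blocks V n) (idx : ℕ → V) (T : ℕ) : Blocks V n :=
  extrapolate (arbcdState g f Lip z0 idx T).t (arbcdState g f Lip z0 idx (T + 1)).u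
    (arbcdState g f Lip z0 idx (T + 1)).z

open Classical in
/-- A point with the smallest value of `Φ` among `y 0, …, y r`. -/
def bestOf {X : Type*} (Φ : X → ℝ) (y : ℕ → X) : ℕ → X
  | 0 => y 0
  | r + 1 => if Φ (y (r + 1)) < Φ (bestOf Φ y r) then y (r + 1) else bestOf Φ y r

end ARBCD

/-! ### The DFAL algorithm

The outer iterations are numbered `k = 0, 1, 2, …`: iteration `k` uses the parameters
`lam k = λ^(k+1)`, `alpha k = α^(k+1)`, `xi k = ξ^(k+1)` and the dual vector `θ^(k+1)`, and
it turns the iterate `x k = x^(k)` into `x (k + 1) = x^(k+1)`. -/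

/-- The data of DFAL: the local cost functions `F_i = ρ_i + γ_i`, the matrix `A` of the
constraint `A x = 0`, and the parameters `c, λ^(1), α^(1), ξ^(1)`. -/
structure Data (V κ : Type*) (n : ℕ) where
  ρ : V → EuclideanSpace ℝ (Fin n) → ℝ
  γ : V → EuclideanSpace ℝ (Fin n) → ℝ
  A : Matrix κ (V × Fin n) ℝ
  c : ℝ
  lam₁ : ℝ
  alpha₁ : ℝ
  xi₁ : ℝ

namespace Data

variable {V κ : Type*} [Fintype V] [DecidableEq V] [Fintype κ] {n : ℕ}

/-- The product `A x` of the matrix with the stacked vector `x ∈ ℝ^{nN}`. -/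
def mulA (D : Data V κ n) (x : Blocks V n) : EuclideanSpace ℝ κ :=
  WithLp.toLp 2 (D.A.mulVec fun q => x q.1 q.2)

/-- `λ^(k+1)`. -/
def lam (D : Data V κ n) (k : ℕ) : ℝ := D.lam₁ * D.c ^ k

/-- `α^(k+1)`. -/
def alpha (D : Data V κ n) (k : ℕ) : ℝ := D.alpha₁ * (D.c ^ 2) ^ k

/-- `ξ^(k+1)`. -/
def xi (D : Data V κ n) (k : ℕ) : ℝ := D.xi₁ * (D.c ^ 2) ^ k

/-- The dual vectors along a sequence `x` of iterates: `D.dual x k = θ^(k+1)`, with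
`θ^(1) = 0` and `θ^(k+2) = θ^(k+1) - A x^(k+1) / λ^(k+1)`. -/
def dual (D : Data V κ n) (x : ℕ → Blocks V n) : ℕ → EuclideanSpace ℝ κ
  | 0 => 0
  | k + 1 => D.dual x k - (D.lam k)⁻¹ • D.mulA (x (k + 1))

/-- The smooth part `f(x) = λ ∑ᵢ γᵢ(xᵢ) + ½‖A x - λ θ‖²` of the subproblem of iteration `k`
with dual vector `θ`. -/
def smoothPart (D : Data V κ n) (k : ℕ) (θ : EuclideanSpace ℝ κ) (x : Blocks V n) : ℝ :=
  D.lam k * ∑ i, D.γ i (x i) + 1 / 2 * ‖D.mulA x - D.lam k • θ‖ ^ 2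

/-- The objective `P(x) = λ ∑ᵢ ρᵢ(xᵢ) + f(x)` of the subproblem of iteration `k`. -/
def subproblem (D : Data V κ n) (k : ℕ) (θ : EuclideanSpace ℝ κ) (x : Blocks V n) : ℝ :=
  D.lam k * ∑ i, D.ρ i (x i) + D.smoothPart k θ x

/-- Condition (a) for the result `x` of iteration `k`: `P(x) - P(x_*) ≤ α` for a minimizer `x_*`. -/
def CondA (D : Data V κ n) (k : ℕ) (θ : EuclideanSpace ℝ κ) (x : Blocks V n) : Prop :=
  ∃ xs, IsMinOn (D.subproblem k θ) Set.univ xs ∧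
    D.subproblem k θ x - D.subproblem k θ xs ≤ D.alpha k

/-- Condition (b): there are `gᵢ ∈ λ ∂ρᵢ(xᵢ) + ∇_{x_i} f(x)` with `maxᵢ ‖gᵢ‖ ≤ ξ / √N`. -/
def CondB (D : Data V κ n) (k : ℕ) (θ : EuclideanSpace ℝ κ) (x : Blocks V n) : Prop :=
  ∃ g : Blocks V n,
    (∀ i, ∃ q ∈ subdiff (D.ρ i) (x i), g i = D.lam k • q + blockGrad (D.smoothPart k θ) i x) ∧
    ∀ i, ‖g i‖ ≤ D.xi k / √(Fintype.card V : ℝ)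

/-- The result `x (k + 1)` of outer iteration `k` satisfies (a) or (b). -/
def Accepted (D : Data V κ n) (x : ℕ → Blocks V n) (k : ℕ) : Prop :=
  D.CondA k (D.dual x k) (x (k + 1)) ∨ D.CondB k (D.dual x k) (x (k + 1))

/-- The integer `N(ε)`: the least integer `≥ 1` that is at least `log_{1/c}(Cbar / ε)`. -/
def outerIters (D : Data V κ n) (Cbar ε : ℝ) : ℕ := max 1 ⌈Real.logb (1 / D.c) (Cbar / ε)⌉₊

/-- The acceptance condition of the asynchronous variant for a random sequence `x` of iterates:
in each of the first `M` outer iterations, given that all the previous iterations were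
successful, (a) or (b) holds with probability at least `(1 - p)^(1/M)`. -/
def AsyncAccepted (D : Data V κ n) {Ω : Type*} [MeasurableSpace Ω] (μ : Measure Ω)
    (x : ℕ → Ω → Blocks V n) (M : ℕ) (p : ℝ) : Prop :=
  ∀ k < M, (1 - p) ^ (1 / (M : ℝ)) ≤
    (ProbabilityTheory.cond μ {ω | ∀ j < k, D.Accepted (fun l => x l ω) j}).real
      {ω | D.Accepted (fun l => x l ω) k}

/-- `ε`-optimal: `|∑ᵢ Fᵢ(xᵢ) - F*| ≤ ε`, where `F* = min_{x ∈ ℝⁿ} ∑ᵢ Fᵢ(x)`. -/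
def EpsOptimal (D : Data V κ n) (ε : ℝ) (x : Blocks V n) : Prop :=
  |∑ i, (D.ρ i (x i) + D.γ i (x i)) -
    ⨅ y : EuclideanSpace ℝ (Fin n), ∑ i, (D.ρ i y + D.γ i y)| ≤ ε

/-- DFAL with ARBCD as the subproblem solver, for step constants `Lip k i` and given sampled
nodes: outer iteration `k` makes `K k + 1` calls to ARBCD started at the current iterate, of
`T k + 1` iterations each (the node drawn in iteration `ℓ` of call `r` is `R k r ℓ`), and keeps
a best output. The value at `k` is `(x^(k), θ^(k+1))`. -/
def arbcdRun (D : Data V κ n) (Lip : ℕ → V → ℝ) (K T : ℕ → ℕ) (x0 : Blocks V n)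
    (R : ℕ → ℕ → ℕ → V) : ℕ → Blocks V n × EuclideanSpace ℝ κ
  | 0 => (x0, 0)
  | k + 1 =>
    let x := (D.arbcdRun Lip K T x0 R k).1
    let θ := (D.arbcdRun Lip K T x0 R k).2
    let x' := bestOf (D.subproblem k θ)
      (fun r => arbcdOutput (fun i y => D.lam k * D.ρ i y) (D.smoothPart k θ) (Lip k) x
        (R k r) (T k)) (K k)
    (x', θ - (D.lam k)⁻¹ • D.mulA x')

/-- The dual vectors produced by the run are those of its sequence of iterates. -/
theorem arbcdRun_snd (D : Data V κ n) (Lip : ℕ → V → ℝ) (K T : ℕ → ℕ) (x0 : Blocks V n)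
    (R : ℕ → ℕ → ℕ → V) (k : ℕ) :
    (D.arbcdRun Lip K T x0 R k).2 = D.dual (fun l => (D.arbcdRun Lip K T x0 R l).1) k := by
  induction k with
  | zero => rfl
  | succ k ih => simp only [dual, ← ih]; rfl

end Data

/-- `ε`-feasible: `‖x_i - x_j‖ ≤ ε` for every edge `(i, j)`. -/
def EpsFeasible {V : Type*} (G : SimpleGraph V) {n : ℕ} (ε : ℝ) (x : Blocks V n) : Prop :=
  ∀ i j, G.Adj i j → ‖x i - x j‖ ≤ ε

/-- The sampled nodes `R · k r ℓ` are independent and uniformly distributed over the nodes. -/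
structure IsUniformSampling {V Ω : Type*} [Fintype V] [MeasurableSpace Ω] (μ : Measure Ω)
    (R : Ω → ℕ → ℕ → ℕ → V) : Prop where
  measurable : ∀ k r ℓ, Measurable[_, ⊤] fun ω => R ω k r ℓ
  uniform : ∀ k r ℓ (i : V), μ.real {ω | R ω k r ℓ = i} = 1 / (Fintype.card V : ℝ)
  indep : iIndepFun (m := fun _ : ℕ × ℕ × ℕ => (⊤ : MeasurableSpace V))
    (fun (s : ℕ × ℕ × ℕ) ω => R ω s.1 s.2.1 s.2.2) μ

end AsyncDFAL

end

/-!
Whichever of (a) and (b) an iterate satisfies, it minimizes the subproblem up to `α^(k)` plus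
`ξ^(k)` times the distance to the comparison point. Since `ξ^(k) / λ^(k) < τ_i`, such inexact
minimizers have values `γ_i - inf γ_i` of size `O(1 + λ^(k) ‖θ^(k)‖²)`, hence gradients of size
`O(1 + √λ^(k) ‖θ^(k)‖)`, and their first order conditions carry this over to `Aᵀ θ^(k+1)`. The dual
vectors lie in the range of `A`, on which `Aᵀ` is bounded below, so they stay bounded; therefore the
constraint residual `A x^(k)` and the suboptimality are `O(λ^(k)) = O(c^k)`.

One call of ARBCD decreases a Lyapunov function on average over the drawn node, which gives an
expected gap `O(1/T²)`. Hence `T_k ~ c^(-k)` iterations suffice for the average gap to be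
`α^(k) / 2`, and by Markov's inequality at most half of the node sequences miss `α^(k)`. All of the
`K ~ log (N(ε) / p)` calls fail together with probability at most
`2^(-K) ≤ p / N(ε) ≤ 1 - (1 - p)^(1/N(ε))`, the last step being Bernoulli's inequality. The sum
`∑ₖ T_k` is geometric, hence `O(1/ε)`.
-/

namespace AsyncDFAL

/-! ### Convex functions -/

section Convex

open Filter InnerProductSpace

section NormedSpace

variable {E : Type*} [NormedAddCommGroup E]

theorem exists_isMinOn_of_coercive [ProperSpace E] {h : E → ℝ} (hc : Continuous h) {a b : ℝ}
    (ha : 0 < a) (hcoer : ∀ x, a * ‖x‖ - b ≤ h x) : ∃ z, IsMinOn h Set.univ z := by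
  have htop : Tendsto (fun x : E => a * ‖x‖ - b) (cocompact E) atTop :=
    tendsto_atTop_add_const_right _ (-b) (tendsto_norm_cocompact_atTop.const_mul_atTop ha)
  obtain ⟨z, hz⟩ := hc.exists_forall_le (tendsto_atTop_mono hcoer htop)
  exact ⟨z, fun y _ => hz y⟩

variable [NormedSpace ℝ E]

theorem exists_strongDual_le_of_convexOn {f : E → ℝ} (hf : ConvexOn ℝ Set.univ f)
    (hc : Continuous f) (x : E) : ∃ l : StrongDual ℝ E, ∀ y, f x + l (y - x) ≤ f y := by
  have hconv : Convex ℝ {p : E × ℝ | f p.1 < p.2} := by simpa using hf.convex_strict_epigraph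
  have hopen : IsOpen {p : E × ℝ | f p.1 < p.2} :=
    isOpen_lt (hc.comp continuous_fst) continuous_snd
  obtain ⟨l, hl⟩ := geometric_hahn_banach_open_point (x := (x, f x)) hconv hopen (by simp)
  have hsplit (y : E) (r : ℝ) : l (y, r) = l (y, 0) + r * l (0, 1) := by
    rw [← smul_eq_mul, ← map_smul, ← map_add]
    simp
  have hslope : l (0, 1) < 0 := by
    have := hl (x, f x + 1) (by simp)
    rw [hsplit x (f x + 1), hsplit x (f x)] at this
    linarith
  have hepi (y : E) : l (y, 0) + f y * l (0, 1) ≤ l (x, 0) + f x * l (0, 1) := by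
    have hlim : Tendsto (fun r : ℝ => l (y, 0) + r * l (0, 1)) (nhdsWithin (f y) (Set.Ioi (f y)))
        (nhds (l (y, 0) + f y * l (0, 1))) :=
      tendsto_nhdsWithin_of_tendsto_nhds (Continuous.tendsto (by fun_prop) _)
    refine le_of_tendsto hlim ?_
    filter_upwards [self_mem_nhdsWithin] with r hr
    rw [← hsplit, ← hsplit]
    exact (hl (y, r) hr).le
  refine ⟨(-l (0, 1))⁻¹ • l.comp (.inl ℝ E ℝ), fun y => ?_⟩
  have hdiff : l (y - x, 0) = l (y, 0) - l (x, 0) := by rw [← map_sub]; simp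
  have hquot : (-l (0, 1))⁻¹ * l (y - x, 0) ≤ f y - f x := by
    rw [inv_mul_le_iff₀ (neg_pos.2 hslope), hdiff]
    linarith [hepi y]
  simpa [add_comm] using add_le_of_le_sub_left hquot

theorem add_sq_le_of_isMinOn_of_strongConvexOn {s : Set E} {m : ℝ} {f : E → ℝ}
    (hf : StrongConvexOn s m f) {z w : E} (hz : z ∈ s) (hw : w ∈ s) (hmin : IsMinOn f s z) :
    f z + m / 2 * ‖w - z‖ ^ 2 ≤ f w := by
  have hsegment (a : ℝ) (ha : 0 < a) (ha' : a ≤ 1) :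
      f z + (1 - a) * (m / 2 * ‖w - z‖ ^ 2) ≤ f w := by
    have hval := hf.2 hz hw (sub_nonneg.2 ha') ha.le (by ring)
    have hle := hmin (hf.1 hz hw (sub_nonneg.2 ha') ha.le (by ring))
    rw [norm_sub_rev] at hval
    simp only [smul_eq_mul, Set.mem_ofPred_eq] at hval hle
    exact le_of_mul_le_mul_left (by linarith) ha
  have hlim : Tendsto (fun a : ℝ => f z + (1 - a) * (m / 2 * ‖w - z‖ ^ 2))
      (nhdsWithin 0 (Set.Ioi 0)) (nhds (f z + (1 - 0) * (m / 2 * ‖w - z‖ ^ 2))) :=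
    tendsto_nhdsWithin_of_tendsto_nhds (Continuous.tendsto (by fun_prop) 0)
  rw [sub_zero, one_mul] at hlim
  refine le_of_tendsto hlim ?_
  filter_upwards [Ioc_mem_nhdsGT (zero_lt_one (α := ℝ))] with a ha using hsegment a ha.1 ha.2

end NormedSpace

section InnerProductSpace

variable {E : Type*} [NormedAddCommGroup E] [InnerProductSpace ℝ E]

theorem strongConvexOn_add_half_norm_sub_sq {s : Set E} {g : E → ℝ} (hg : ConvexOn ℝ s g) (x : E) :
    StrongConvexOn s 1 fun y => g y + 1 / 2 * ‖y - x‖ ^ 2 := by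
  rw [strongConvexOn_iff_convex]
  have haffine : ConvexOn ℝ s fun y => -inner ℝ x y + 1 / 2 * ‖x‖ ^ 2 :=
    ((-innerSL ℝ x).toLinearMap.convexOn hg.1).add_const _
  refine (hg.add haffine).congr fun y _ => ?_
  simp only [Pi.add_apply, norm_sub_sq_real, real_inner_comm x y]
  ring

/-- Here `b * ‖d‖ + ⟪g, d⟫ + l / 2 * ‖d‖ ^ 2` bounds the change of a composite objective under a
step `d`; the estimate comes from `d = -s g / ‖g‖`. -/
theorem norm_le_of_forall_neg_le {g : E} {α b l s : ℝ} (hα : 0 ≤ α) (hb : 0 ≤ b) (hl : 0 ≤ l)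
    (hs : 0 < s) (h : ∀ d, -α ≤ b * ‖d‖ + inner ℝ g d + l / 2 * ‖d‖ ^ 2) :
    ‖g‖ ≤ α / s + b + l / 2 * s := by
  rcases eq_or_ne g 0 with rfl | hg
  · rw [norm_zero]; positivity
  have hg' : 0 < ‖g‖ := norm_pos_iff.2 hg
  have hstep := h (-(s / ‖g‖) • g)
  have hinner : -(s / ‖g‖) * ‖g‖ ^ 2 = -(s * ‖g‖) := by field_simp
  rw [inner_smul_right, real_inner_self_eq_norm_sq, norm_smul, norm_neg,
    Real.norm_of_nonneg (by positivity), div_mul_cancel₀ _ hg'.ne', hinner] at hstep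
  have hcancel : s * (α / s) = α := mul_div_cancel₀ α hs.ne'
  exact le_of_mul_le_mul_left (by linarith) hs

variable [CompleteSpace E]

theorem add_inner_gradient_le_of_convexOn {γ : E → ℝ} (hγ : ConvexOn ℝ Set.univ γ) {x : E}
    (hd : DifferentiableAt ℝ γ x) (y : E) : γ x + inner ℝ (gradient γ x) (y - x) ≤ γ y := by
  have hline : ConvexOn ℝ Set.univ (γ ∘ AffineMap.lineMap x y) := hγ.comp_affineMap _
  have hder : HasDerivAt (γ ∘ AffineMap.lineMap x y) (inner ℝ (gradient γ x) (y - x)) (0 : ℝ) := by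
    rw [inner_gradient_left]
    refine HasFDerivAt.comp_hasDerivAt 0 ?_ AffineMap.hasDerivAt_lineMap
    simpa using hd.hasFDerivAt
  have hslope := hline.le_slope_of_hasDerivAt (Set.mem_univ 0) (Set.mem_univ 1) one_pos hder
  simp only [slope_def_field, Function.comp_apply, AffineMap.lineMap_apply_one,
    AffineMap.lineMap_apply_zero, sub_zero, div_one] at hslope
  linarith

theorem le_add_inner_gradient_add_sq {γ : E → ℝ} {L : ℝ≥0} (hd : Differentiable ℝ γ)
    (hL : LipschitzWith L (gradient γ)) (x d : E) :
    γ (x + d) ≤ γ x + inner ℝ (gradient γ x) d + L / 2 * ‖d‖ ^ 2 := by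
  let gap : ℝ → ℝ := fun s =>
    γ (x + s • d) - s * inner ℝ (gradient γ x) d - L / 2 * ‖d‖ ^ 2 * s ^ 2
  have hder (s : ℝ) : HasDerivAt gap (inner ℝ (gradient γ (x + s • d)) d
      - inner ℝ (gradient γ x) d - L / 2 * ‖d‖ ^ 2 * (2 * s)) s := by
    have hpath : HasDerivAt (fun s : ℝ => x + s • d) d s := by
      simpa using ((hasDerivAt_id s).smul_const d).const_add x
    have hcomp := (hd (x + s • d)).hasFDerivAt.comp_hasDerivAt s hpath
    rw [← inner_gradient_left] at hcomp
    exact (hcomp.sub (hasDerivAt_mul_const _)).sub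
      (by simpa using (hasDerivAt_pow 2 s).const_mul (L / 2 * ‖d‖ ^ 2))
  have hanti : AntitoneOn gap (Set.Icc 0 1) := by
    refine antitoneOn_of_deriv_nonpos (convex_Icc 0 1)
      (fun s _ => (hder s).continuousAt.continuousWithinAt)
      (fun s _ => (hder s).differentiableAt.differentiableWithinAt) fun s hs => ?_
    rw [interior_Icc] at hs
    have hcauchy : inner ℝ (gradient γ (x + s • d) - gradient γ x) d
        ≤ ‖gradient γ (x + s • d) - gradient γ x‖ * ‖d‖ := real_inner_le_norm _ _
    have hlip : ‖gradient γ (x + s • d) - gradient γ x‖ ≤ L * (s * ‖d‖) := by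
      have := hL.norm_sub_le (x + s • d) x
      rwa [add_sub_cancel_left, norm_smul, Real.norm_of_nonneg hs.1.le] at this
    rw [(hder s).deriv, ← inner_sub_left]
    linarith [mul_le_mul_of_nonneg_right hlip (norm_nonneg d)]
  have hends := hanti (Set.left_mem_Icc.2 zero_le_one) (Set.right_mem_Icc.2 zero_le_one) zero_le_one
  simp only [gap, one_smul, zero_smul, add_zero] at hends
  linarith

theorem norm_gradient_sq_le {γ : E → ℝ} {L : ℝ≥0} (hd : Differentiable ℝ γ)
    (hL : LipschitzWith L (gradient γ)) {m : ℝ} (hm : ∀ x, m ≤ γ x) (x : E) :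
    ‖gradient γ x‖ ^ 2 ≤ 2 * L * (γ x - m) := by
  set a := ‖gradient γ x‖ ^ 2 with ha
  have hquadratic (s : ℝ) : 0 ≤ L / 2 * a * (s * s) + a * s + (γ x - m) := by
    have hstep := (hm _).trans (le_add_inner_gradient_add_sq hd hL x (s • gradient γ x))
    rw [inner_smul_right, real_inner_self_eq_norm_sq, norm_smul, mul_pow, Real.norm_eq_abs, sq_abs,
      ← ha] at hstep
    linarith
  have hdiscrim : a * a ≤ 2 * L * (γ x - m) * a := by
    have := discrim_le_zero hquadratic
    rw [discrim] at this
    linarith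
  rcases (sq_nonneg ‖gradient γ x‖).eq_or_lt with h0 | h0
  · rw [ha, ← h0]
    exact mul_nonneg (by positivity) (sub_nonneg.2 (hm x))
  · exact le_of_mul_le_mul_right hdiscrim h0

end InnerProductSpace

section EuclideanSpace

variable {n : ℕ} {ρ g : EuclideanSpace ℝ (Fin n) → ℝ}

theorem subdiff_nonempty (hρ : ConvexOn ℝ Set.univ ρ) (x : EuclideanSpace ℝ (Fin n)) :
    (subdiff ρ x).Nonempty := by
  obtain ⟨l, hl⟩ := exists_strongDual_le_of_convexOn hρ hρ.locallyLipschitz.continuous x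
  refine ⟨(toDual ℝ _).symm l, fun y => ?_⟩
  rw [toDual_symm_apply]
  exact hl y

theorem sub_le_mul_norm_sub_of_subdiff_bounded (hρ : ConvexOn ℝ Set.univ ρ) {B : ℝ}
    (hB : ∀ x, ∀ q ∈ subdiff ρ x, ‖q‖ ≤ B) (x y : EuclideanSpace ℝ (Fin n)) :
    ρ x - ρ y ≤ B * ‖x - y‖ := by
  obtain ⟨q, hq⟩ := subdiff_nonempty hρ x
  calc ρ x - ρ y ≤ -inner ℝ q (y - x) := by linarith [hq y]
    _ = inner ℝ q (x - y) := by rw [← inner_neg_right, neg_sub]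
    _ ≤ ‖q‖ * ‖x - y‖ := real_inner_le_norm _ _
    _ ≤ B * ‖x - y‖ := by gcongr; exact hB x q hq

theorem isMinOn_prox (hg : ConvexOn ℝ Set.univ g) (hg0 : ∀ x, 0 ≤ g x)
    (x : EuclideanSpace ℝ (Fin n)) :
    IsMinOn (fun y => g y + 1 / 2 * ‖y - x‖ ^ 2) Set.univ (prox g x) := by
  have hc : Continuous g := hg.locallyLipschitz.continuous
  refine Classical.epsilon_spec (p := fun z => IsMinOn (fun y => g y + 1 / 2 * ‖y - x‖ ^ 2)
    Set.univ z) (exists_isMinOn_of_coercive (a := 1) (b := ‖x‖ + 1 / 2) (by fun_prop) one_pos ?_)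
  intro y
  nlinarith [hg0 y, norm_sub_norm_le y x, sq_nonneg (‖y - x‖ - 1)]

theorem prox_three_point (hg : ConvexOn ℝ Set.univ g) (hg0 : ∀ x, 0 ≤ g x)
    (x w : EuclideanSpace ℝ (Fin n)) :
    g (prox g x) + 1 / 2 * ‖prox g x - x‖ ^ 2 + 1 / 2 * ‖w - prox g x‖ ^ 2
      ≤ g w + 1 / 2 * ‖w - x‖ ^ 2 :=
  add_sq_le_of_isMinOn_of_strongConvexOn (strongConvexOn_add_half_norm_sub_sq hg x)
    (Set.mem_univ _) (Set.mem_univ w) (isMinOn_prox hg hg0 x)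

end EuclideanSpace

end Convex

/-! ### Step sizes and iterates of ARBCD -/

section StepSize

/-- The step sizes `t^(ℓ)` of ARBCD for `N` blocks, as a function of `ℓ`. -/
noncomputable def stepSize (N : ℝ) : ℕ → ℝ
  | 0 => 1
  | ℓ + 1 => (1 + √(1 + (2 * N * stepSize N ℓ) ^ 2)) / (2 * N)

/-- The weight `1 / (N t^(ℓ))` with which the `z`-variable of ARBCD enters the point where the
gradient is evaluated. -/
noncomputable def momentum (N : ℝ) (ℓ : ℕ) : ℝ := (N * stepSize N ℓ)⁻¹

variable {N : ℝ}

theorem stepSize_add_le_succ (hN : 0 < N) (ℓ : ℕ) :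
    stepSize N ℓ + 1 / (2 * N) ≤ stepSize N (ℓ + 1) := by
  have hsqrt : 2 * N * stepSize N ℓ ≤ √(1 + (2 * N * stepSize N ℓ) ^ 2) :=
    Real.le_sqrt_of_sq_le (by linarith)
  have hmul : (stepSize N ℓ + 1 / (2 * N)) * (2 * N) = 2 * N * stepSize N ℓ + 1 := by field_simp
  rw [stepSize, le_div_iff₀ (by positivity)]
  linarith

theorem one_add_div_le_stepSize (hN : 0 < N) (ℓ : ℕ) : 1 + ℓ / (2 * N) ≤ stepSize N ℓ := by
  induction ℓ with
  | zero => simp [stepSize]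
  | succ ℓ ih =>
    push_cast
    rw [add_div]
    linarith [stepSize_add_le_succ hN ℓ]

theorem one_le_stepSize (hN : 0 < N) (ℓ : ℕ) : 1 ≤ stepSize N ℓ :=
  (le_add_of_nonneg_right (by positivity)).trans (one_add_div_le_stepSize hN ℓ)

theorem stepSize_pos (hN : 0 < N) (ℓ : ℕ) : 0 < stepSize N ℓ :=
  one_pos.trans_le (one_le_stepSize hN ℓ)

theorem stepSize_succ_sq_mul (hN : 0 < N) (ℓ : ℕ) :
    stepSize N (ℓ + 1) ^ 2 * (1 - momentum N (ℓ + 1)) = stepSize N ℓ ^ 2 := by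
  have hsq : √(1 + (2 * N * stepSize N ℓ) ^ 2) ^ 2 = 1 + (2 * N * stepSize N ℓ) ^ 2 :=
    Real.sq_sqrt (by positivity)
  have hpos := stepSize_pos hN (ℓ + 1)
  have hroot : 2 * N * stepSize N (ℓ + 1) - 1 = √(1 + (2 * N * stepSize N ℓ) ^ 2) := by
    rw [stepSize]
    field_simp
    ring
  rw [← hroot] at hsq
  rw [momentum]
  field_simp
  refine mul_left_cancel₀ (mul_pos four_pos hN).ne' ?_
  linear_combination hsq

theorem momentum_sq_succ (hN : 0 < N) (ℓ : ℕ) :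
    momentum N (ℓ + 1) ^ 2 = (1 - momentum N (ℓ + 1)) * momentum N ℓ ^ 2 := by
  have hpos := stepSize_pos hN ℓ
  have hpos' := stepSize_pos hN (ℓ + 1)
  have hsq := stepSize_succ_sq_mul hN ℓ
  simp only [momentum] at hsq ⊢
  field_simp at hsq ⊢
  linear_combination -hsq

theorem one_le_mul_stepSize (hN : 1 ≤ N) (ℓ : ℕ) : 1 ≤ N * stepSize N ℓ :=
  one_le_mul_of_one_le_of_one_le hN (one_le_stepSize (one_pos.trans_le hN) ℓ)

theorem momentum_le_one (hN : 1 ≤ N) (ℓ : ℕ) : momentum N ℓ ≤ 1 :=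
  inv_le_one_of_one_le₀ (one_le_mul_stepSize hN ℓ)

end StepSize

section ConvexAverage

variable {E : Type*} [AddCommGroup E] [Module ℝ E] {ψ : E → ℝ} {β θ s Ψ : ℝ} {x z : E}

/-- `x` is a convex combination of some points, the last of which is `z` with weight `β`, and `Ψ`
dominates the same combination of the values of `ψ`. The other points are merged into one point
`w`, with a bound `r` for the merged value. -/
def IsConvexAverage (ψ : E → ℝ) (β : ℝ) (x z : E) (Ψ : ℝ) : Prop :=
  ∃ w r, ψ w ≤ r ∧ x = (1 - β) • w + β • z ∧ Ψ = (1 - β) * r + β * ψ z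

theorem IsConvexAverage.le (h : IsConvexAverage ψ β x z Ψ) (hψ : ConvexOn ℝ Set.univ ψ)
    (hβ₀ : 0 ≤ β) (hβ₁ : β ≤ 1) : ψ x ≤ Ψ := by
  obtain ⟨w, r, hr, rfl, rfl⟩ := h
  calc ψ ((1 - β) • w + β • z) ≤ (1 - β) * ψ w + β * ψ z :=
        hψ.2 (Set.mem_univ w) (Set.mem_univ z) (sub_nonneg.2 hβ₁) hβ₀ (by ring)
    _ ≤ (1 - β) * r + β * ψ z := by gcongr

theorem exists_smul_add_smul_eq_of_convexOn (hψ : ConvexOn ℝ Set.univ ψ) {w z : E} {r p q : ℝ}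
    (hr : ψ w ≤ r) (hp : 0 ≤ p) (hq : 0 ≤ q) : ∃ w' r', ψ w' ≤ r' ∧
      p • w + q • z = (p + q) • w' ∧ p * r + q * ψ z = (p + q) * r' := by
  rcases (add_nonneg hp hq).eq_or_lt with h0 | hpos
  · obtain ⟨rfl, rfl⟩ := (add_eq_zero_iff_of_nonneg hp hq).1 h0.symm
    exact ⟨w, r, hr, by simp, by simp⟩
  · have hweights : p / (p + q) + q / (p + q) = 1 := by rw [← add_div, div_self hpos.ne']
    have hw' : 0 ≤ p / (p + q) := by positivity
    refine ⟨(p / (p + q)) • w + (q / (p + q)) • z, p / (p + q) * r + q / (p + q) * ψ z, ?_, ?_, ?_⟩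
    · exact (hψ.2 (Set.mem_univ w) (Set.mem_univ z) hw' (by positivity) hweights).trans
        (add_le_add_left (mul_le_mul_of_nonneg_left hr hw') _)
    · rw [smul_add, smul_smul, smul_smul, mul_div_cancel₀ _ hpos.ne', mul_div_cancel₀ _ hpos.ne']
    · field_simp

theorem IsConvexAverage.step (h : IsConvexAverage ψ β x z Ψ) (hψ : ConvexOn ℝ Set.univ ψ)
    (hβ : β ≤ 1) (hθ : θ ≤ 1) (hs : s - θ ≤ (1 - θ) * β) (z' : E) :
    IsConvexAverage ψ s ((1 - θ) • x + θ • z + s • (z' - z)) z'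
      ((1 - θ) * Ψ + θ * ψ z + s * (ψ z' - ψ z)) := by
  obtain ⟨w, r, hr, rfl, rfl⟩ := h
  obtain ⟨w', r', hr', hw', hval⟩ := exists_smul_add_smul_eq_of_convexOn hψ (z := z) hr
    (mul_nonneg (sub_nonneg.2 hθ) (sub_nonneg.2 hβ)) (sub_nonneg.2 hs)
  have htotal : (1 - θ) * (1 - β) + ((1 - θ) * β - (s - θ)) = 1 - s := by ring
  rw [htotal] at hw' hval
  refine ⟨w', r', hr', ?_, ?_⟩
  · rw [← hw']
    module
  · rw [← hval]
    ring

end ConvexAverage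

section Iterates

variable {V : Type*} [Fintype V] {n : ℕ}

theorem convexOn_sum_blocks {g : V → EuclideanSpace ℝ (Fin n) → ℝ}
    (hg : ∀ i, ConvexOn ℝ Set.univ (g i)) :
    ConvexOn ℝ Set.univ fun x : Blocks V n => ∑ i, g i (x i) := by
  refine ⟨convex_univ, fun x _ y _ a b ha hb hab => ?_⟩
  rw [smul_eq_mul, smul_eq_mul, Finset.mul_sum, Finset.mul_sum, ← Finset.sum_add_distrib]
  exact Finset.sum_le_sum fun i _ => (hg i).2 (Set.mem_univ _) (Set.mem_univ _) ha hb hab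

variable [DecidableEq V] (g : V → EuclideanSpace ℝ (Fin n) → ℝ) (f : Blocks V n → ℝ)
  (Lip : V → ℝ) (z0 : Blocks V n) (idx : ℕ → V)

/-- The point at which iteration `ℓ` of ARBCD evaluates the gradient of `f`. -/
noncomputable def queryPoint (ℓ : ℕ) : Blocks V n :=
  extrapolate (stepSize (Fintype.card V) ℓ) (arbcdState g f Lip z0 idx ℓ).u
    (arbcdState g f Lip z0 idx ℓ).z

/-- The proximal gradient step, with step size `t`, that ARBCD makes from the block `z i` with the
gradient of `f` at `y`. -/
noncomputable def proxStep (t : ℝ) (y z : Blocks V n) (i : V) : EuclideanSpace ℝ (Fin n) :=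
  prox (fun v => t / Lip i * g i v) (z i - (t / Lip i) • blockGrad f i y)

/-- The main sequence of ARBCD: its term `ℓ + 1` is the output after `ℓ + 1` iterations. -/
noncomputable def mainSeq : ℕ → Blocks V n
  | 0 => z0
  | ℓ + 1 => arbcdOutput g f Lip z0 idx ℓ

/-- The combination of the values `∑ᵢ gᵢ(zᵢ^(m))`, `m ≤ ℓ`, with the weights that express the term
`ℓ` of `mainSeq` through the `z^(m)`. -/
noncomputable def averagedCost : ℕ → ℝ
  | 0 => ∑ i, g i (z0 i)
  | ℓ + 1 =>
    (1 - momentum (Fintype.card V) ℓ) * averagedCost ℓ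
      + momentum (Fintype.card V) ℓ * ∑ i, g i ((arbcdState g f Lip z0 idx ℓ).z i)
      + (stepSize (Fintype.card V) ℓ)⁻¹ * (∑ i, g i ((arbcdState g f Lip z0 idx (ℓ + 1)).z i)
        - ∑ i, g i ((arbcdState g f Lip z0 idx ℓ).z i))

theorem arbcdState_t (ℓ : ℕ) : (arbcdState g f Lip z0 idx ℓ).t = stepSize (Fintype.card V) ℓ := by
  induction ℓ with
  | zero => rfl
  | succ ℓ ih => simp only [arbcdState, arbcdStep, stepSize, ih]

theorem arbcdState_succ_z (ℓ : ℕ) :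
    (arbcdState g f Lip z0 idx (ℓ + 1)).z = Function.update (arbcdState g f Lip z0 idx ℓ).z (idx ℓ)
      (proxStep g f Lip (stepSize (Fintype.card V) ℓ) (queryPoint g f Lip z0 idx ℓ)
        (arbcdState g f Lip z0 idx ℓ).z (idx ℓ)) := by
  simp only [arbcdState, arbcdStep, arbcdState_t, queryPoint, proxStep]

theorem arbcdState_succ_u (ℓ : ℕ) :
    (arbcdState g f Lip z0 idx (ℓ + 1)).u = (arbcdState g f Lip z0 idx ℓ).u +
      ((Fintype.card V : ℝ) ^ 2 * stepSize (Fintype.card V) ℓ *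
        (1 - stepSize (Fintype.card V) ℓ)) •
        ((arbcdState g f Lip z0 idx (ℓ + 1)).z - (arbcdState g f Lip z0 idx ℓ).z) := by
  funext j
  simp only [arbcdState, arbcdStep, arbcdState_t, Pi.add_apply, Pi.smul_apply, Pi.sub_apply]
  by_cases hj : j = idx ℓ
  · subst hj
    simp only [Function.update_self]
  · simp only [Function.update_of_ne hj, sub_self, smul_zero, add_zero]

theorem queryPoint_eq [Nonempty V] (ℓ : ℕ) :
    queryPoint g f Lip z0 idx ℓ =
      (1 - momentum (Fintype.card V) ℓ) • mainSeq g f Lip z0 idx ℓ +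
        momentum (Fintype.card V) ℓ • (arbcdState g f Lip z0 idx ℓ).z := by
  have hN : (0 : ℝ) < Fintype.card V := by exact_mod_cast Fintype.card_pos
  cases ℓ with
  | zero => simp [queryPoint, extrapolate, arbcdState, mainSeq, ← add_smul]
  | succ ℓ =>
    simp only [queryPoint, mainSeq, arbcdOutput, arbcdState_t, extrapolate, one_div]
    rw [← momentum, ← momentum, momentum_sq_succ hN]
    module

theorem mainSeq_succ [Nonempty V] (ℓ : ℕ) :
    mainSeq g f Lip z0 idx (ℓ + 1) = queryPoint g f Lip z0 idx ℓ +
      (stepSize (Fintype.card V) ℓ)⁻¹ •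
        ((arbcdState g f Lip z0 idx (ℓ + 1)).z - (arbcdState g f Lip z0 idx ℓ).z) := by
  have hN : (0 : ℝ) < Fintype.card V := by exact_mod_cast Fintype.card_pos
  have ht := stepSize_pos hN ℓ
  have hweight : (1 / (Fintype.card V * stepSize (Fintype.card V) ℓ)) ^ 2 *
      ((Fintype.card V : ℝ) ^ 2 * stepSize (Fintype.card V) ℓ * (1 - stepSize (Fintype.card V) ℓ))
        = (stepSize (Fintype.card V) ℓ)⁻¹ - 1 := by
    field_simp
  simp only [mainSeq, queryPoint, arbcdOutput, arbcdState_t, extrapolate]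
  rw [arbcdState_succ_u, smul_add, smul_smul, hweight]
  module

theorem exists_isConvexAverage_mainSeq [Nonempty V] (hg : ∀ i, ConvexOn ℝ Set.univ (g i)) (ℓ : ℕ) :
    ∃ β : ℝ, 0 ≤ β ∧ β ≤ 1 ∧
      (Fintype.card V - 1 : ℝ) ≤ (Fintype.card V * stepSize (Fintype.card V) ℓ - 1) * β ∧
      IsConvexAverage (fun x : Blocks V n => ∑ i, g i (x i)) β (mainSeq g f Lip z0 idx ℓ)
        (arbcdState g f Lip z0 idx ℓ).z (averagedCost g f Lip z0 idx ℓ) := by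
  have hN : (1 : ℝ) ≤ Fintype.card V := by exact_mod_cast Fintype.card_pos
  have hN' : (0 : ℝ) < Fintype.card V := one_pos.trans_le hN
  induction ℓ with
  | zero =>
    exact ⟨1, zero_le_one, le_rfl, by simp [stepSize], z0, ∑ i, g i (z0 i), le_rfl,
      by simp [mainSeq, arbcdState], by simp [averagedCost, arbcdState]⟩
  | succ ℓ ih =>
    obtain ⟨β, -, hβ₁, hβ, havg⟩ := ih
    have ht := one_le_stepSize hN' ℓ
    have ht₀ := stepSize_pos hN' ℓ
    refine ⟨(stepSize (Fintype.card V) ℓ)⁻¹, by positivity, inv_le_one_of_one_le₀ ht, ?_, ?_⟩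
    · have hgrow := mul_le_mul_of_nonneg_left (stepSize_add_le_succ hN' ℓ) hN'.le
      rw [mul_add, show (Fintype.card V : ℝ) * (1 / (2 * Fintype.card V)) = 1 / 2 by field_simp]
        at hgrow
      rw [← div_eq_mul_inv, le_div_iff₀ ht₀]
      linarith
    · rw [mainSeq_succ, queryPoint_eq]
      refine havg.step (convexOn_sum_blocks hg) hβ₁ (momentum_le_one hN ℓ) ?_ _
      rw [momentum, inv_eq_one_div, ← sub_nonneg]
      field_simp
      linarith

theorem sum_mainSeq_le_averagedCost [Nonempty V] (hg : ∀ i, ConvexOn ℝ Set.univ (g i)) (ℓ : ℕ) :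
    ∑ i, g i (mainSeq g f Lip z0 idx ℓ i) ≤ averagedCost g f Lip z0 idx ℓ := by
  obtain ⟨β, hβ₀, hβ₁, -, havg⟩ := exists_isConvexAverage_mainSeq g f Lip z0 idx hg ℓ
  exact havg.le (convexOn_sum_blocks hg) hβ₀ hβ₁

variable {idx} {idx' : ℕ → V}

theorem arbcdState_congr {ℓ : ℕ} (h : ∀ m < ℓ, idx m = idx' m) :
    arbcdState g f Lip z0 idx ℓ = arbcdState g f Lip z0 idx' ℓ := by
  induction ℓ with
  | zero => rfl
  | succ ℓ ih =>
    simp only [arbcdState]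
    rw [ih fun m hm => h m (hm.trans ℓ.lt_succ_self), h ℓ ℓ.lt_succ_self]

theorem arbcdOutput_congr {T : ℕ} (h : ∀ m < T + 1, idx m = idx' m) :
    arbcdOutput g f Lip z0 idx T = arbcdOutput g f Lip z0 idx' T := by
  simp only [arbcdOutput]
  rw [arbcdState_congr g f Lip z0 h,
    arbcdState_congr g f Lip z0 fun m hm => h m (hm.trans T.lt_succ_self)]

theorem queryPoint_congr {ℓ : ℕ} (h : ∀ m < ℓ, idx m = idx' m) :
    queryPoint g f Lip z0 idx ℓ = queryPoint g f Lip z0 idx' ℓ := by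
  rw [queryPoint, queryPoint, arbcdState_congr g f Lip z0 h]

theorem mainSeq_congr {ℓ : ℕ} (h : ∀ m < ℓ, idx m = idx' m) :
    mainSeq g f Lip z0 idx ℓ = mainSeq g f Lip z0 idx' ℓ := by
  cases ℓ with
  | zero => rfl
  | succ ℓ => exact arbcdOutput_congr g f Lip z0 h

theorem averagedCost_congr {ℓ : ℕ} (h : ∀ m < ℓ, idx m = idx' m) :
    averagedCost g f Lip z0 idx ℓ = averagedCost g f Lip z0 idx' ℓ := by
  induction ℓ with
  | zero => rfl
  | succ ℓ ih =>
    have h' : ∀ m < ℓ, idx m = idx' m := fun m hm => h m (hm.trans ℓ.lt_succ_self)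
    simp only [averagedCost]
    rw [ih h', arbcdState_congr g f Lip z0 h, arbcdState_congr g f Lip z0 h']

end Iterates

/-! ### Convergence rate of ARBCD -/

section Rate

open Finset

theorem sum_update_apply {V β M : Type*} [Fintype V] [DecidableEq V] [AddCommGroup M]
    (h : V → β → M) (z : V → β) (i : V) (b : β) :
    ∑ j, h j (Function.update z i b j) = ∑ j, h j (z j) + (h i b - h i (z i)) := by
  have hrest : ∑ j ∈ univ.erase i, h j (Function.update z i b j) = ∑ j ∈ univ.erase i, h j (z j) :=
    sum_congr rfl fun j hj => by rw [Function.update_of_ne (ne_of_mem_erase hj)]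
  rw [← add_sum_erase _ _ (mem_univ i), ← add_sum_erase _ (fun j => h j (z j)) (mem_univ i), hrest,
    Function.update_self]
  abel

/-- Extends a finite sequence of nodes to an infinite one, since `arbcdState` takes an infinite
sequence of drawn nodes; the entries from `m` on have no effect on the first `m` iterations. -/
noncomputable def extendSeq {V : Type*} [Nonempty V] {m : ℕ} (h : Fin m → V) (ℓ : ℕ) : V :=
  if hl : ℓ < m then h ⟨ℓ, hl⟩ else Classical.arbitrary V

theorem extendSeq_snoc {V : Type*} [Nonempty V] {m : ℕ} (h : Fin m → V) (i : V) :
    ∀ l < m + 1, extendSeq (Fin.snoc (α := fun _ => V) h i) l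
      = Function.update (extendSeq h) m i l := by
  intro l hl
  rcases Nat.lt_succ_iff_lt_or_eq.1 hl with hlt | rfl
  · rw [Function.update_of_ne hlt.ne]
    simp only [extendSeq, hl, hlt, dif_pos]
    exact Fin.snoc_castSucc (α := fun _ => V) i h ⟨l, hlt⟩
  · rw [Function.update_self]
    simp only [extendSeq, hl, dif_pos]
    exact Fin.snoc_last (α := fun _ => V) i h

theorem prox_gradient_step_le {n : ℕ} {g : EuclideanSpace ℝ (Fin n) → ℝ}
    (hg : ConvexOn ℝ Set.univ g) (hg₀ : ∀ x, 0 ≤ g x) {t l : ℝ} (ht : 0 ≤ t) (hl : 0 < l)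
    (z G w : EuclideanSpace ℝ (Fin n)) :
    let v := prox (fun y => t / l * g y) (z - (t / l) • G)
    t * g v + t * inner ℝ G (v - z) + l / 2 * ‖v - z‖ ^ 2 + l / 2 * ‖v - w‖ ^ 2
      ≤ t * g w + t * inner ℝ G (w - z) + l / 2 * ‖z - w‖ ^ 2 := by
  intro v
  have hs : 0 ≤ t / l := by positivity
  have hthree := prox_three_point (hg.smul hs) (fun x => smul_nonneg hs (hg₀ x)) (z - (t / l) • G) w
  have hexpand (x : EuclideanSpace ℝ (Fin n)) : ‖x - (z - (t / l) • G)‖ ^ 2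
      = ‖x - z‖ ^ 2 + 2 * (t / l * inner ℝ G (x - z)) + ‖(t / l) • G‖ ^ 2 := by
    rw [sub_sub_eq_add_sub, add_sub_right_comm, norm_add_sq_real, inner_smul_right, real_inner_comm]
  change t / l * g v + 1 / 2 * ‖v - (z - (t / l) • G)‖ ^ 2 + 1 / 2 * ‖w - v‖ ^ 2
    ≤ t / l * g w + _ at hthree
  rw [hexpand, hexpand, norm_sub_rev w v, norm_sub_rev w z] at hthree
  have hscaled := mul_le_mul_of_nonneg_left hthree hl.le
  field_simp at hscaled
  linarith

variable {V : Type*} [Fintype V] [DecidableEq V] {n : ℕ}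

/-- The objective `∑ᵢ gᵢ(xᵢ) + f(x)` of the composite problem solved by ARBCD. -/
def composite (g : V → EuclideanSpace ℝ (Fin n) → ℝ) (f : Blocks V n → ℝ) (x : Blocks V n) : ℝ :=
  ∑ i, g i (x i) + f x

/-- The assumptions under which ARBCD converges: convex nonnegative `gᵢ`, and a convex `f`, whose
convexity is expressed through the block gradients, which satisfy the descent inequality with
constants `Lip i`. -/
structure IsCompositeProblem (g : V → EuclideanSpace ℝ (Fin n) → ℝ) (f : Blocks V n → ℝ)
    (Lip : V → ℝ) : Prop where
  convex : ∀ i, ConvexOn ℝ Set.univ (g i)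
  nonneg : ∀ i x, 0 ≤ g i x
  lip_pos : ∀ i, 0 < Lip i
  linear_le : ∀ x w, f x + ∑ i, inner ℝ (blockGrad f i x) (w i - x i) ≤ f w
  descent : ∀ x i d, f (Function.update x i (x i + d)) ≤
    f x + inner ℝ (blockGrad f i x) d + Lip i / 2 * ‖d‖ ^ 2

/-- The Lyapunov function of ARBCD with respect to a comparison point `w`. -/
noncomputable def lyapunov (g : V → EuclideanSpace ℝ (Fin n) → ℝ) (f : Blocks V n → ℝ)
    (Lip : V → ℝ) (z0 w : Blocks V n) (idx : ℕ → V) (ℓ : ℕ) : ℝ :=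
  stepSize (Fintype.card V) ℓ ^ 2 * (1 - momentum (Fintype.card V) ℓ) *
    (f (mainSeq g f Lip z0 idx ℓ) + averagedCost g f Lip z0 idx ℓ - composite g f w) +
    ∑ i, Lip i / 2 * ‖(arbcdState g f Lip z0 idx ℓ).z i - w i‖ ^ 2

variable {g : V → EuclideanSpace ℝ (Fin n) → ℝ} {f : Blocks V n → ℝ} {Lip : V → ℝ}

theorem IsCompositeProblem.proxStep_le (hP : IsCompositeProblem g f Lip) {t : ℝ} (ht : 0 < t)
    (y z w : Blocks V n) (i : V) :
    let v := proxStep g f Lip t y z i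
    t ^ 2 * f (Function.update y i (y i + t⁻¹ • (v - z i))) + t * g i v
        + Lip i / 2 * ‖v - w i‖ ^ 2
      ≤ t ^ 2 * f y + t * g i (w i) + t * inner ℝ (blockGrad f i y) (w i - z i)
        + Lip i / 2 * ‖z i - w i‖ ^ 2 := by
  intro v
  have hprox : t * g i v + t * inner ℝ (blockGrad f i y) (v - z i) + Lip i / 2 * ‖v - z i‖ ^ 2
      + Lip i / 2 * ‖v - w i‖ ^ 2 ≤ t * g i (w i) + t * inner ℝ (blockGrad f i y) (w i - z i)
      + Lip i / 2 * ‖z i - w i‖ ^ 2 :=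
    prox_gradient_step_le (hP.convex i) (hP.nonneg i) ht.le (hP.lip_pos i) (z i) _ (w i)
  have hdescent := mul_le_mul_of_nonneg_left (hP.descent y i (t⁻¹ • (v - z i))) (sq_nonneg t)
  rw [inner_smul_right, norm_smul, Real.norm_of_nonneg (by positivity)] at hdescent
  field_simp at hdescent hprox ⊢
  linarith

theorem IsCompositeProblem.sum_inner_blockGrad_le (hP : IsCompositeProblem g f Lip) {a : ℝ}
    (ha : 1 ≤ a) {x y z : Blocks V n} (hy : a • y = (a - 1) • x + z) (w : Blocks V n) :
    ∑ i, inner ℝ (blockGrad f i y) (w i - z i) ≤ f w + (a - 1) * f x - a * f y := by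
  have hsplit (i : V) : w i - z i = (w i - y i) + (a - 1) • (x i - y i) := by
    have hyi : a • y i = (a - 1) • x i + z i := congrFun hy i
    rw [eq_sub_of_add_eq' hyi.symm]
    module
  simp only [hsplit, inner_add_right, inner_smul_right, sum_add_distrib, ← mul_sum]
  linarith [hP.linear_le y w, mul_le_mul_of_nonneg_left (hP.linear_le y x) (sub_nonneg.2 ha)]

theorem lyapunov_congr (z0 w : Blocks V n) {idx idx' : ℕ → V} {ℓ : ℕ}
    (h : ∀ m < ℓ, idx m = idx' m) :
    lyapunov g f Lip z0 w idx ℓ = lyapunov g f Lip z0 w idx' ℓ := by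
  simp only [lyapunov]
  rw [mainSeq_congr g f Lip z0 h, averagedCost_congr g f Lip z0 h, arbcdState_congr g f Lip z0 h]

variable [Nonempty V]

theorem lyapunov_succ_le (hP : IsCompositeProblem g f Lip) (z0 w : Blocks V n) (idx : ℕ → V)
    (ℓ : ℕ) :
    let t := stepSize (Fintype.card V) ℓ
    let θ := momentum (Fintype.card V) ℓ
    let y := queryPoint g f Lip z0 idx ℓ
    let z := (arbcdState g f Lip z0 idx ℓ).z
    lyapunov g f Lip z0 w idx (ℓ + 1)
      ≤ t ^ 2 * (f y + (1 - θ) * averagedCost g f Lip z0 idx ℓ + θ * ∑ j, g j (z j)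
          - composite g f w)
        + ∑ j, Lip j / 2 * ‖z j - w j‖ ^ 2 + t * (g (idx ℓ) (w (idx ℓ)) - g (idx ℓ) (z (idx ℓ)))
        + t * inner ℝ (blockGrad f (idx ℓ) y) (w (idx ℓ) - z (idx ℓ)) := by
  intro t θ y z
  have hN : (0 : ℝ) < Fintype.card V := by exact_mod_cast Fintype.card_pos
  have ht : 0 < t := stepSize_pos hN ℓ
  set v := proxStep g f Lip t y z (idx ℓ)
  have hz : (arbcdState g f Lip z0 idx (ℓ + 1)).z = Function.update z (idx ℓ) v :=
    arbcdState_succ_z g f Lip z0 idx ℓ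
  have hx : mainSeq g f Lip z0 idx (ℓ + 1)
      = Function.update y (idx ℓ) (y (idx ℓ) + t⁻¹ • (v - z (idx ℓ))) := by
    rw [mainSeq_succ, hz]
    funext j
    by_cases hj : j = idx ℓ
    · subst hj; simp [t, y, z]
    · simp [Function.update_of_ne hj, y, z]
  have hΨ : averagedCost g f Lip z0 idx (ℓ + 1) = (1 - θ) * averagedCost g f Lip z0 idx ℓ
      + θ * ∑ j, g j (z j) + t⁻¹ * (g (idx ℓ) v - g (idx ℓ) (z (idx ℓ))) := by
    rw [averagedCost, hz, sum_update_apply g z, add_sub_cancel_left]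
  have hcancel : t ^ 2 * (t⁻¹ * (g (idx ℓ) v - g (idx ℓ) (z (idx ℓ))))
      = t * (g (idx ℓ) v - g (idx ℓ) (z (idx ℓ))) := by field_simp
  rw [lyapunov, stepSize_succ_sq_mul hN, hx, hΨ, hz,
    sum_update_apply (fun j u => Lip j / 2 * ‖u - w j‖ ^ 2)]
  linarith [hP.proxStep_le ht y z w (idx ℓ)]

theorem sum_lyapunov_succ_le (hP : IsCompositeProblem g f Lip) (z0 w : Blocks V n) (idx : ℕ → V)
    (ℓ : ℕ) :
    ∑ i, lyapunov g f Lip z0 w (Function.update idx ℓ i) (ℓ + 1)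
      ≤ Fintype.card V * lyapunov g f Lip z0 w idx ℓ := by
  have hN : (1 : ℝ) ≤ Fintype.card V := by exact_mod_cast Fintype.card_pos
  set N : ℝ := (Fintype.card V : ℝ)
  have ht : 0 < stepSize N ℓ := stepSize_pos (one_pos.trans_le hN) ℓ
  have hθ : N * stepSize N ℓ * momentum N ℓ = 1 := mul_inv_cancel₀ (by positivity)
  set t := stepSize N ℓ
  set θ := momentum N ℓ
  set x := mainSeq g f Lip z0 idx ℓ
  set y := queryPoint g f Lip z0 idx ℓ
  set z := (arbcdState g f Lip z0 idx ℓ).z with hz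
  set Ψ := averagedCost g f Lip z0 idx ℓ
  have hy : (N * t) • y = (N * t - 1) • x + z := by
    rw [show y = (1 - θ) • x + θ • z from queryPoint_eq g f Lip z0 idx ℓ, smul_add, smul_smul,
      smul_smul, hθ, one_smul, mul_sub, hθ, mul_one]
  have hstep (i : V) : lyapunov g f Lip z0 w (Function.update idx ℓ i) (ℓ + 1)
      ≤ t ^ 2 * (f y + (1 - θ) * Ψ + θ * ∑ j, g j (z j) - composite g f w)
        + ∑ j, Lip j / 2 * ‖z j - w j‖ ^ 2 + t * (g i (w i) - g i (z i))
        + t * inner ℝ (blockGrad f i y) (w i - z i) := by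
    have hpast : ∀ m < ℓ, Function.update idx ℓ i m = idx m := fun m hm =>
      Function.update_of_ne hm.ne _ _
    have hle := lyapunov_succ_le hP z0 w (Function.update idx ℓ i) ℓ
    simpa only [queryPoint_congr g f Lip z0 hpast, arbcdState_congr g f Lip z0 hpast,
      averagedCost_congr g f Lip z0 hpast, Function.update_self] using hle
  refine (sum_le_sum fun i _ => hstep i).trans ?_
  simp only [sum_add_distrib, sum_sub_distrib, sum_const, card_univ, nsmul_eq_mul, ← mul_sum]
  have hinner := mul_le_mul_of_nonneg_left
    (hP.sum_inner_blockGrad_le (one_le_mul_stepSize hN ℓ) hy w) ht.le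
  rw [lyapunov, ← hz, composite]
  linear_combination hinner + t * (∑ i, g i (z i) + f x - ∑ i, g i (w i) - f w) * hθ

theorem sum_lyapunov_le (hP : IsCompositeProblem g f Lip) (z0 w : Blocks V n) (idx : ℕ → V)
    (m : ℕ) :
    ∑ h : Fin m → V, lyapunov g f Lip z0 w (extendSeq h) m
      ≤ (Fintype.card V : ℝ) ^ m * lyapunov g f Lip z0 w idx 0 := by
  induction m with
  | zero =>
    rw [Fintype.sum_unique, pow_zero, one_mul]
    exact (lyapunov_congr z0 w fun m hm => absurd hm m.not_lt_zero).le
  | succ m ih =>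
    rw [← (Fin.snocEquiv fun _ : Fin (m + 1) => V).sum_comp, Fintype.sum_prod_type_right]
    calc ∑ h : Fin m → V, ∑ i,
          lyapunov g f Lip z0 w (extendSeq (Fin.snoc (α := fun _ => V) h i)) (m + 1)
        = ∑ h : Fin m → V, ∑ i,
          lyapunov g f Lip z0 w (Function.update (extendSeq h) m i) (m + 1) :=
          sum_congr rfl fun h _ => sum_congr rfl fun i _ => lyapunov_congr z0 w (extendSeq_snoc h i)
      _ ≤ ∑ h : Fin m → V, Fintype.card V * lyapunov g f Lip z0 w (extendSeq h) m :=
          sum_le_sum fun h _ => sum_lyapunov_succ_le hP z0 w (extendSeq h) m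
      _ ≤ (Fintype.card V : ℝ) ^ (m + 1) * lyapunov g f Lip z0 w idx 0 := by
          rw [← mul_sum, pow_succ', mul_assoc]
          gcongr

theorem sum_arbcdOutput_le (hP : IsCompositeProblem g f Lip) (z0 w : Blocks V n) (T : ℕ) :
    ∑ h : Fin (T + 1) → V, stepSize (Fintype.card V) T ^ 2 *
        (composite g f (arbcdOutput g f Lip z0 (extendSeq h) T) - composite g f w)
      ≤ (Fintype.card V : ℝ) ^ (T + 1) *
        ((1 - (Fintype.card V : ℝ)⁻¹) * (composite g f z0 - composite g f w)
          + ∑ i, Lip i / 2 * ‖z0 i - w i‖ ^ 2) := by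
  have hN : (0 : ℝ) < Fintype.card V := by exact_mod_cast Fintype.card_pos
  have hstart : lyapunov g f Lip z0 w (fun _ => Classical.arbitrary V) 0
      = (1 - (Fintype.card V : ℝ)⁻¹) * (composite g f z0 - composite g f w)
          + ∑ i, Lip i / 2 * ‖z0 i - w i‖ ^ 2 := by
    simp only [lyapunov, composite, momentum, stepSize, mainSeq, averagedCost, arbcdState]
    ring_nf
  rw [← hstart]
  refine (sum_le_sum fun s _ => ?_).trans (sum_lyapunov_le hP z0 w _ (T + 1))
  have hdist : 0 ≤ ∑ i, Lip i / 2 *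
      ‖(arbcdState g f Lip z0 (extendSeq s) (T + 1)).z i - w i‖ ^ 2 :=
    sum_nonneg fun i _ => mul_nonneg (half_pos (hP.lip_pos i)).le (sq_nonneg _)
  have haverage : composite g f (arbcdOutput g f Lip z0 (extendSeq s) T)
      ≤ f (arbcdOutput g f Lip z0 (extendSeq s) T)
        + averagedCost g f Lip z0 (extendSeq s) (T + 1) := by
    rw [composite, add_comm]
    exact add_le_add_right
      (sum_mainSeq_le_averagedCost g f Lip z0 (extendSeq s) hP.convex (T + 1)) _
  rw [lyapunov, stepSize_succ_sq_mul hN, mainSeq]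
  exact le_add_of_le_of_nonneg
    (mul_le_mul_of_nonneg_left (sub_le_sub_right haverage _) (sq_nonneg _)) hdist

theorem card_filter_lt_mul_le_sum {ι : Type*} [Fintype ι] {Δ : ι → ℝ} {a : ℝ} (hΔ : ∀ i, 0 ≤ Δ i)
    [DecidablePred fun i => a < Δ i] : (#{i | a < Δ i} : ℝ) * a ≤ ∑ i, Δ i := by
  rw [← nsmul_eq_mul, ← sum_const]
  exact (sum_le_sum fun i hi => (mem_filter.1 hi).2.le).trans
    (sum_le_sum_of_subset_of_nonneg (filter_subset _ _) fun i _ _ => hΔ i)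

open Classical in
theorem two_mul_card_not_optimal_le (hP : IsCompositeProblem g f Lip) {z0 w : Blocks V n} {T : ℕ}
    {α : ℝ} (hα : 0 < α) (hw : IsMinOn (composite g f) Set.univ w)
    (hT : 2 * (composite g f z0 - composite g f w + ∑ i, Lip i / 2 * ‖z0 i - w i‖ ^ 2)
      ≤ stepSize (Fintype.card V) T ^ 2 * α) :
    2 * (#{h : Fin (T + 1) → V | α < composite g f (arbcdOutput g f Lip z0 (extendSeq h) T)
      - composite g f w} : ℝ) ≤ (Fintype.card V : ℝ) ^ (T + 1) := by
  have hN : (0 : ℝ) < Fintype.card V := by exact_mod_cast Fintype.card_pos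
  have hgap (x : Blocks V n) : 0 ≤ composite g f x - composite g f w :=
    sub_nonneg.2 (hw (Set.mem_univ x))
  set Δ : (Fin (T + 1) → V) → ℝ := fun h =>
    composite g f (arbcdOutput g f Lip z0 (extendSeq h) T) - composite g f w
  have hpos : 0 < stepSize (Fintype.card V) T ^ 2 * α :=
    mul_pos (pow_pos (stepSize_pos hN T) 2) hα
  have hmean : (1 - (Fintype.card V : ℝ)⁻¹) * (composite g f z0 - composite g f w)
      ≤ composite g f z0 - composite g f w :=
    mul_le_of_le_one_left (hgap z0) (sub_le_self 1 (by positivity))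
  refine le_of_mul_le_mul_right ?_ hpos
  calc 2 * (#{h | α < Δ h} : ℝ) * (stepSize (Fintype.card V) T ^ 2 * α)
      = 2 * stepSize (Fintype.card V) T ^ 2 * (#{h | α < Δ h} * α) := by ring
    _ ≤ 2 * stepSize (Fintype.card V) T ^ 2 * ∑ h, Δ h := by
        gcongr
        exact card_filter_lt_mul_le_sum fun h => hgap _
    _ = 2 * ∑ h, stepSize (Fintype.card V) T ^ 2 * Δ h := by rw [← mul_sum, mul_assoc]
    _ ≤ 2 * ((Fintype.card V : ℝ) ^ (T + 1) *
          ((1 - (Fintype.card V : ℝ)⁻¹) * (composite g f z0 - composite g f w)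
            + ∑ i, Lip i / 2 * ‖z0 i - w i‖ ^ 2)) := by
        gcongr
        exact sum_arbcdOutput_le hP z0 w T
    _ = (Fintype.card V : ℝ) ^ (T + 1) *
          (2 * ((1 - (Fintype.card V : ℝ)⁻¹) * (composite g f z0 - composite g f w)
            + ∑ i, Lip i / 2 * ‖z0 i - w i‖ ^ 2)) := by ring
    _ ≤ (Fintype.card V : ℝ) ^ (T + 1) * (stepSize (Fintype.card V) T ^ 2 * α) := by
        exact mul_le_mul_of_nonneg_left (by linarith) (by positivity)

end Rate

/-! ### The constraint operator -/

section QuadraticForm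

variable {V ι : Type*} [Fintype V] [Fintype ι] [DecidableEq ι]

theorem dotProduct_kronecker_one_mulVec (M : Matrix V V ℝ) (v : V × ι → ℝ) :
    v ⬝ᵥ ((M ⊗ₖ (1 : Matrix ι ι ℝ)) *ᵥ v)
      = ∑ l, (fun i => v (i, l)) ⬝ᵥ (M *ᵥ fun i => v (i, l)) := by
  simp only [dotProduct, Matrix.mulVec, Matrix.kroneckerMap_apply, Fintype.sum_prod_type,
    Matrix.one_apply, mul_ite, mul_one, mul_zero, ite_mul, zero_mul, Finset.sum_ite_eq,
    Finset.mem_univ, if_true]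
  exact Finset.sum_comm

end QuadraticForm

namespace Data

section Linear

variable {V κ : Type*} [Fintype V] {n : ℕ} (D : Data V κ n)

/-- The map `x ↦ A x` as a linear map. -/
def mulAₗ : Blocks V n →ₗ[ℝ] EuclideanSpace ℝ κ where
  toFun := D.mulA
  map_add' x y := by
    ext s
    simp [mulA, Matrix.mulVec, dotProduct, mul_add, Finset.sum_add_distrib]
  map_smul' a x := by
    ext s
    simp [mulA, Matrix.mulVec, dotProduct, Finset.mul_sum, mul_left_comm]

theorem mulA_zero : D.mulA 0 = 0 :=
  D.mulAₗ.map_zero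

theorem mulA_add (x y : Blocks V n) : D.mulA (x + y) = D.mulA x + D.mulA y :=
  D.mulAₗ.map_add x y

theorem mulA_sub (x y : Blocks V n) : D.mulA (x - y) = D.mulA x - D.mulA y :=
  D.mulAₗ.map_sub x y

theorem continuous_mulA : Continuous D.mulA :=
  (PiLp.continuous_toLp 2 _).comp <| continuous_const.matrix_mulVec (by fun_prop)

end Linear

section Adjoint

variable {V κ : Type*} [Fintype κ] {n : ℕ} (D : Data V κ n)

/-- The map `r ↦ Aᵀ r`, with values in blocks. It is written out because `Blocks V n` carries the
sup norm over the nodes, so `LinearMap.adjoint` does not apply. -/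
def adjA : EuclideanSpace ℝ κ →ₗ[ℝ] Blocks V n where
  toFun r i := WithLp.toLp 2 fun l => ∑ s, D.A s (i, l) * r s
  map_add' r r' := by
    ext i l
    simp [mul_add, Finset.sum_add_distrib]
  map_smul' a r := by
    ext i l
    simp [Finset.mul_sum, mul_left_comm]

variable [Fintype V]

theorem inner_mulA (r : EuclideanSpace ℝ κ) (x : Blocks V n) :
    inner ℝ r (D.mulA x) = ∑ i, inner ℝ (D.adjA r i) (x i) := by
  simp only [mulA, adjA, PiLp.inner_apply, Matrix.mulVec, dotProduct, RCLike.inner_apply,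
    conj_trivial, LinearMap.coe_mk, AddHom.coe_mk, Fintype.sum_prod_type, Finset.mul_sum,
    Finset.sum_mul]
  rw [Finset.sum_comm]
  refine Finset.sum_congr rfl fun i _ => ?_
  rw [Finset.sum_comm]
  refine Finset.sum_congr rfl fun l _ => Finset.sum_congr rfl fun s _ => ?_
  ring

-- `Aᵀ` is injective on the range of `A`, hence bounded below there.
theorem exists_norm_le_of_mem_range :
    ∃ C : ℝ, 0 ≤ C ∧ ∀ θ ∈ LinearMap.range D.mulAₗ, ∀ b : ℝ, 0 ≤ b →
      (∀ i, ‖D.adjA θ i‖ ≤ b) → ‖θ‖ ≤ C * b := by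
  let adjOnRange : LinearMap.range D.mulAₗ →ₗ[ℝ] Blocks V n := D.adjA.comp (Submodule.subtype _)
  have hker : LinearMap.ker adjOnRange = ⊥ := by
    rw [LinearMap.ker_eq_bot']
    rintro ⟨θ, w, rfl⟩ (hw : D.adjA (D.mulA w) = 0)
    have hinner := D.inner_mulA (D.mulA w) w
    simp only [hw, Pi.zero_apply, inner_zero_left, Finset.sum_const_zero] at hinner
    exact Subtype.ext (inner_self_eq_zero.1 hinner)
  obtain ⟨C, -, hC⟩ := adjOnRange.exists_antilipschitzWith hker
  refine ⟨C, C.2, fun θ hθ b hb hadj => ?_⟩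
  have hnorm : ‖θ‖ ≤ C * ‖D.adjA θ‖ := by
    have := hC.le_mul_dist ⟨θ, hθ⟩ 0
    rwa [map_zero, dist_zero_right, dist_zero_right] at this
  exact hnorm.trans (mul_le_mul_of_nonneg_left ((pi_norm_le_iff_of_nonneg hb).2 hadj) C.2)

theorem norm_mulA_sq_eq_dotProduct (x : Blocks V n) :
    ‖D.mulA x‖ ^ 2
      = (fun q : V × Fin n => x q.1 q.2) ⬝ᵥ ((D.Aᵀ * D.A) *ᵥ fun q => x q.1 q.2) := by
  rw [← Matrix.mulVec_mulVec, Matrix.dotProduct_mulVec, Matrix.vecMul_transpose,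
    EuclideanSpace.real_norm_sq_eq]
  simp [mulA, dotProduct, sq]

end Adjoint

section Laplacian

variable {V κ : Type*} [Fintype V] [DecidableEq V] [Fintype κ] {n : ℕ}
  {G : SimpleGraph V} [DecidableRel G.Adj] {D : Data V κ n}

theorem norm_mulA_sq_eq_sum_lapMatrix
    (hA : D.Aᵀ * D.A = G.lapMatrix ℝ ⊗ₖ (1 : Matrix (Fin n) (Fin n) ℝ))
    (x : Blocks V n) :
    ‖D.mulA x‖ ^ 2 = ∑ l : Fin n, (fun i => x i l) ⬝ᵥ (G.lapMatrix ℝ *ᵥ fun i => x i l) := by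
  rw [norm_mulA_sq_eq_dotProduct, hA, dotProduct_kronecker_one_mulVec]

theorem norm_mulA_single_sq
    (hA : D.Aᵀ * D.A = G.lapMatrix ℝ ⊗ₖ (1 : Matrix (Fin n) (Fin n) ℝ))
    (i : V) (d : EuclideanSpace ℝ (Fin n)) :
    ‖D.mulA (Pi.single i d)‖ ^ 2 = G.degree i * ‖d‖ ^ 2 := by
  have hcoord : ∀ l : Fin n, (fun j => (Pi.single i d : Blocks V n) j l) = Pi.single i (d l) := by
    intro l
    funext j
    by_cases hj : j = i
    · subst hj; simp
    · simp [hj]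
  have hdiag : G.lapMatrix ℝ i i = G.degree i := by
    simp [SimpleGraph.lapMatrix, SimpleGraph.degMatrix]
  rw [norm_mulA_sq_eq_sum_lapMatrix hA, EuclideanSpace.real_norm_sq_eq, Finset.mul_sum]
  refine Finset.sum_congr rfl fun l _ => ?_
  rw [hcoord, single_dotProduct, Matrix.mulVec_single, Pi.smul_apply, Matrix.col_apply, hdiag,
    op_smul_eq_smul, smul_eq_mul]
  ring

theorem norm_mulA_sq
    (hA : D.Aᵀ * D.A = G.lapMatrix ℝ ⊗ₖ (1 : Matrix (Fin n) (Fin n) ℝ))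
    (x : Blocks V n) :
    ‖D.mulA x‖ ^ 2 = (∑ i, ∑ j, if G.Adj i j then ‖x i - x j‖ ^ 2 else 0) / 2 := by
  have hcoord : ∀ l : Fin n, (fun i => x i l) ⬝ᵥ (G.lapMatrix ℝ *ᵥ fun i => x i l)
      = (∑ i, ∑ j, if G.Adj i j then (x i l - x j l) ^ 2 else 0) / 2 := fun l => by
    rw [← G.lapMatrix_toLinearMap₂' ℝ, Matrix.toLinearMap₂'_apply']
  simp only [norm_mulA_sq_eq_sum_lapMatrix hA, hcoord, ← Finset.sum_div]
  rw [Finset.sum_comm]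
  congr! 2 with i
  rw [Finset.sum_comm]
  congr! 1 with j
  split_ifs
  · simp [EuclideanSpace.real_norm_sq_eq]
  · simp

theorem norm_sub_le_norm_mulA
    (hA : D.Aᵀ * D.A = G.lapMatrix ℝ ⊗ₖ (1 : Matrix (Fin n) (Fin n) ℝ))
    (x : Blocks V n) {i j : V} (hij : G.Adj i j) :
    ‖x i - x j‖ ≤ ‖D.mulA x‖ := by
  refine le_of_sq_le_sq ?_ (norm_nonneg _)
  rw [norm_mulA_sq hA, le_div_iff₀ two_pos]
  have hterm : ∀ k l, 0 ≤ if G.Adj k l then ‖x k - x l‖ ^ 2 else 0 := fun k l => by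
    split_ifs <;> positivity
  have hrow : ∀ {k l}, G.Adj k l →
      ‖x k - x l‖ ^ 2 ≤ ∑ l, if G.Adj k l then ‖x k - x l‖ ^ 2 else 0 := fun {k l} hkl => by
    simpa [hkl] using Finset.single_le_sum (fun l _ => hterm k l) (Finset.mem_univ l)
  calc ‖x i - x j‖ ^ 2 * 2 = ‖x i - x j‖ ^ 2 + ‖x j - x i‖ ^ 2 := by
        rw [norm_sub_rev (x j)]; ring
    _ ≤ _ := add_le_add (hrow hij) (hrow hij.symm)
    _ ≤ _ := Finset.add_le_sum
        (f := fun k => ∑ l, if G.Adj k l then ‖x k - x l‖ ^ 2 else 0)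
        (fun k _ => Finset.sum_nonneg fun l _ => hterm k l)
        (Finset.mem_univ i) (Finset.mem_univ j) hij.ne

theorem norm_sub_le_length_mul
    (hA : D.Aᵀ * D.A = G.lapMatrix ℝ ⊗ₖ (1 : Matrix (Fin n) (Fin n) ℝ))
    (x : Blocks V n) {i j : V} (p : G.Walk i j) :
    ‖x i - x j‖ ≤ p.length * ‖D.mulA x‖ := by
  induction p with
  | nil => simp
  | @cons u v w hadj p ih =>
    calc ‖x u - x w‖ ≤ ‖x u - x v‖ + ‖x v - x w‖ := norm_sub_le_norm_sub_add_norm_sub _ _ _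
      _ ≤ ‖D.mulA x‖ + p.length * ‖D.mulA x‖ := add_le_add (norm_sub_le_norm_mulA hA x hadj) ih
      _ = _ := by rw [SimpleGraph.Walk.length_cons]; push_cast; ring

theorem norm_sub_le_card_mul
    (hA : D.Aᵀ * D.A = G.lapMatrix ℝ ⊗ₖ (1 : Matrix (Fin n) (Fin n) ℝ))
    (hG : G.Connected) (x : Blocks V n) (i j : V) :
    ‖x i - x j‖ ≤ Fintype.card V * ‖D.mulA x‖ := by
  obtain ⟨p, hp⟩ := (hG.preconnected i j).exists_isPath
  refine (norm_sub_le_length_mul hA x p).trans (mul_le_mul_of_nonneg_right ?_ (norm_nonneg _))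
  exact_mod_cast hp.length_lt.le

theorem smoothPart_update
    (hA : D.Aᵀ * D.A = G.lapMatrix ℝ ⊗ₖ (1 : Matrix (Fin n) (Fin n) ℝ))
    (k : ℕ) (θ : EuclideanSpace ℝ κ) (x : Blocks V n) (i : V) (y : EuclideanSpace ℝ (Fin n)) :
    D.smoothPart k θ (Function.update x i y) = D.smoothPart k θ x
      + D.lam k * (D.γ i y - D.γ i (x i))
      + inner ℝ (D.adjA (D.mulA x - D.lam k • θ) i) (y - x i)
      + G.degree i / 2 * ‖y - x i‖ ^ 2 := by
  have hupd : Function.update x i y = x + Pi.single i (y - x i) := by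
    funext j
    by_cases hj : j = i
    · subst hj; simp
    · simp [hj]
  have hγ : ∑ j, D.γ j (Function.update x i y j)
      = ∑ j, D.γ j (x j) + (D.γ i y - D.γ i (x i)) := sum_update_apply D.γ x i y
  have hinner : ∑ j, inner ℝ (D.adjA (D.mulA x - D.lam k • θ) j)
      ((Pi.single i (y - x i) : Blocks V n) j)
      = inner ℝ (D.adjA (D.mulA x - D.lam k • θ) i) (y - x i) := by
    rw [Finset.sum_eq_single i (fun j _ hj => by simp [hj]) (by simp), Pi.single_eq_same]
  rw [smoothPart, hγ, hupd, mulA_add, add_sub_right_comm, norm_add_sq_real,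
    norm_mulA_single_sq hA, inner_mulA, hinner, smoothPart]
  ring

theorem blockGrad_smoothPart
    (hA : D.Aᵀ * D.A = G.lapMatrix ℝ ⊗ₖ (1 : Matrix (Fin n) (Fin n) ℝ))
    (hd : ∀ i, Differentiable ℝ (D.γ i)) (k : ℕ)
    (θ : EuclideanSpace ℝ κ) (i : V) (x : Blocks V n) :
    blockGrad (D.smoothPart k θ) i x
      = D.lam k • gradient (D.γ i) (x i) + D.adjA (D.mulA x - D.lam k • θ) i := by
  refine HasGradientAt.gradient ?_
  rw [hasGradientAt_iff_hasFDerivAt]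
  simp only [smoothPart_update hA]
  set a := D.adjA (D.mulA x - D.lam k • θ) i
  have hsub := (hasFDerivAt_id (𝕜 := ℝ) (x i)).sub_const (x i)
  have hcost : HasFDerivAt (fun y => D.smoothPart k θ x + D.lam k * (D.γ i y - D.γ i (x i)))
      (D.lam k • fderiv ℝ (D.γ i) (x i)) (x i) :=
    (((hd i (x i)).hasFDerivAt.sub_const _).const_mul _).const_add _
  have hlinear : HasFDerivAt (fun y => inner ℝ a (y - x i)) (innerSL ℝ a) (x i) :=
    (innerSL ℝ a).hasFDerivAt.comp (x i) hsub
  have hquad : HasFDerivAt (fun y => (G.degree i : ℝ) / 2 * ‖y - x i‖ ^ 2)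
      (0 : EuclideanSpace ℝ (Fin n) →L[ℝ] ℝ) (x i) := by
    simpa using hsub.norm_sq.const_mul ((G.degree i : ℝ) / 2)
  have hdual : InnerProductSpace.toDual ℝ _ (D.lam k • gradient (D.γ i) (x i) + a)
      = D.lam k • fderiv ℝ (D.γ i) (x i) + innerSL ℝ a + 0 := by
    ext v
    simp
  rw [hdual]
  exact (hcost.add hlinear).add hquad

end Laplacian

end Data

/-! ### Inexact minimizers of the subproblems -/

namespace Data

section Cost

variable {V κ : Type*} [Fintype V] {n : ℕ}

/-- The separable cost `F(x) = ∑ᵢ Fᵢ(xᵢ)` of a stacked vector. -/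
def cost (D : Data V κ n) (x : Blocks V n) : ℝ :=
  ∑ i, (D.ρ i (x i) + D.γ i (x i))

variable [Fintype κ]

theorem subproblem_eq_cost (D : Data V κ n) (k : ℕ) (θ : EuclideanSpace ℝ κ) (x : Blocks V n) :
    D.subproblem k θ x = D.lam k * D.cost x + 1 / 2 * ‖D.mulA x - D.lam k • θ‖ ^ 2 := by
  rw [subproblem, smoothPart, cost, Finset.sum_add_distrib]
  ring

theorem subproblem_eq_composite (D : Data V κ n) (k : ℕ) (θ : EuclideanSpace ℝ κ) :
    D.subproblem k θ = composite (fun i y => D.lam k * D.ρ i y) (D.smoothPart k θ) := by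
  funext x
  rw [subproblem, composite, Finset.mul_sum]

/-- `x` minimizes the subproblem of iteration `k` up to `α^(k+1)` and to first order up to
`ξ^(k+1)`. Both acceptance conditions (a) and (b) imply this, and the convergence analysis uses
nothing else about them. -/
def NearMin (D : Data V κ n) (k : ℕ) (θ : EuclideanSpace ℝ κ) (x : Blocks V n) : Prop :=
  ∀ w, D.subproblem k θ x ≤ D.subproblem k θ w + D.alpha k + D.xi k * ∑ i, ‖x i - w i‖

end Cost

variable {V κ : Type*} [Fintype V] [DecidableEq V] [Fintype κ] {n : ℕ}

/-- The standing assumptions on the problem and on the parameters of DFAL. -/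
structure IsAdmissible (D : Data V κ n) (G : SimpleGraph V) [DecidableRel G.Adj]
    (L : V → ℝ≥0) (τ : V → ℝ) : Prop where
  connected : G.Connected
  smooth : ∀ i, IsSmoothTerm (D.γ i) (L i)
  nonsmooth : ∀ i, IsNonsmoothTerm (D.ρ i) (τ i)
  gram : D.Aᵀ * D.A = G.lapMatrix ℝ ⊗ₖ (1 : Matrix (Fin n) (Fin n) ℝ)
  c_pos : 0 < D.c
  c_lt_one : D.c < 1
  lam₁_pos : 0 < D.lam₁
  alpha₁_pos : 0 < D.alpha₁
  xi₁_pos : 0 < D.xi₁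
  xi₁_div_lam₁_lt : ∀ i, D.xi₁ / D.lam₁ < τ i

variable {G : SimpleGraph V} [DecidableRel G.Adj] {D : Data V κ n} {L : V → ℝ≥0} {τ : V → ℝ}

namespace IsAdmissible

theorem nonempty (hD : D.IsAdmissible G L τ) : Nonempty V := hD.connected.nonempty

theorem lam_pos (hD : D.IsAdmissible G L τ) (k : ℕ) : 0 < D.lam k :=
  mul_pos hD.lam₁_pos (pow_pos hD.c_pos k)

theorem alpha_pos (hD : D.IsAdmissible G L τ) (k : ℕ) : 0 < D.alpha k :=
  mul_pos hD.alpha₁_pos (pow_pos (pow_pos hD.c_pos 2) k)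

theorem xi_pos (hD : D.IsAdmissible G L τ) (k : ℕ) : 0 < D.xi k :=
  mul_pos hD.xi₁_pos (pow_pos (pow_pos hD.c_pos 2) k)

theorem c_pow_le_one (hD : D.IsAdmissible G L τ) (k : ℕ) : D.c ^ k ≤ 1 :=
  pow_le_one₀ hD.c_pos.le hD.c_lt_one.le

theorem lam_le_lam₁ (hD : D.IsAdmissible G L τ) (k : ℕ) : D.lam k ≤ D.lam₁ :=
  mul_le_of_le_one_right hD.lam₁_pos.le (hD.c_pow_le_one k)

theorem alpha_eq_lam_mul (hD : D.IsAdmissible G L τ) (k : ℕ) :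
    D.alpha k = D.lam k * (D.alpha₁ / D.lam₁ * D.c ^ k) := by
  have := hD.lam₁_pos.ne'
  rw [alpha, lam, ← pow_mul, mul_comm 2 k, pow_mul]
  field_simp

theorem xi_eq_lam_mul (hD : D.IsAdmissible G L τ) (k : ℕ) :
    D.xi k = D.lam k * (D.xi₁ / D.lam₁ * D.c ^ k) := by
  have := hD.lam₁_pos.ne'
  rw [xi, lam, ← pow_mul, mul_comm 2 k, pow_mul]
  field_simp

theorem rho_nonneg (hD : D.IsAdmissible G L τ) (i : V) (x : EuclideanSpace ℝ (Fin n)) :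
    0 ≤ D.ρ i x :=
  (mul_nonneg (hD.nonsmooth i).tau_pos.le (norm_nonneg x)).trans ((hD.nonsmooth i).coercive x)

theorem continuous_rho (hD : D.IsAdmissible G L τ) (i : V) : Continuous (D.ρ i) :=
  (hD.nonsmooth i).convex.locallyLipschitz.continuous

theorem continuous_gamma (hD : D.IsAdmissible G L τ) (i : V) : Continuous (D.γ i) :=
  (hD.smooth i).differentiable.continuous

theorem blockGrad_eq (hD : D.IsAdmissible G L τ) (k : ℕ) (θ : EuclideanSpace ℝ κ) (i : V)
    (x : Blocks V n) :
    blockGrad (D.smoothPart k θ) i x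
      = D.lam k • gradient (D.γ i) (x i) + D.adjA (D.mulA x - D.lam k • θ) i :=
  blockGrad_smoothPart hD.gram (fun i => (hD.smooth i).differentiable) k θ i x

-- `θ - A x / λ` is the next dual vector.
theorem blockGrad_eq_smul (hD : D.IsAdmissible G L τ) (k : ℕ) (θ : EuclideanSpace ℝ κ) (i : V)
    (x : Blocks V n) :
    blockGrad (D.smoothPart k θ) i x
      = D.lam k • (gradient (D.γ i) (x i) - D.adjA (θ - (D.lam k)⁻¹ • D.mulA x) i) := by
  rw [hD.blockGrad_eq, smul_sub, ← Pi.smul_apply (D.lam k) (D.adjA _), ← map_smul, smul_sub,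
    smul_inv_smul₀ (hD.lam_pos k).ne', ← neg_sub (D.lam k • θ), map_neg, Pi.neg_apply,
    ← sub_eq_add_neg]

theorem smoothPart_linear_le (hD : D.IsAdmissible G L τ) (k : ℕ) (θ : EuclideanSpace ℝ κ)
    (x w : Blocks V n) :
    D.smoothPart k θ x + ∑ i, inner ℝ (blockGrad (D.smoothPart k θ) i x) (w i - x i)
      ≤ D.smoothPart k θ w := by
  set r := D.mulA x - D.lam k • θ with hr
  have hresidual : D.mulA w - D.lam k • θ = r + D.mulA (w - x) := by
    rw [hr, mulA_sub]; abel
  have hinner : ∑ i, inner ℝ (blockGrad (D.smoothPart k θ) i x) (w i - x i)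
      = D.lam k * ∑ i, inner ℝ (gradient (D.γ i) (x i)) (w i - x i)
        + inner ℝ r (D.mulA (w - x)) := by
    simp only [hD.blockGrad_eq, inner_add_left, inner_smul_left, conj_trivial,
      Finset.sum_add_distrib, ← Finset.mul_sum, D.inner_mulA, Pi.sub_apply, hr]
  have hγ : D.lam k * ∑ i, (D.γ i (x i) + inner ℝ (gradient (D.γ i) (x i)) (w i - x i))
      ≤ D.lam k * ∑ i, D.γ i (w i) :=
    mul_le_mul_of_nonneg_left (Finset.sum_le_sum fun i _ => add_inner_gradient_le_of_convexOn
      (hD.smooth i).convex ((hD.smooth i).differentiable _) _) (hD.lam_pos k).le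
  rw [Finset.sum_add_distrib] at hγ
  rw [hinner, smoothPart, smoothPart, hresidual, norm_add_sq_real]
  linarith [sq_nonneg ‖D.mulA (w - x)‖]

theorem smoothPart_descent (hD : D.IsAdmissible G L τ) (k : ℕ) (θ : EuclideanSpace ℝ κ)
    (x : Blocks V n) (i : V) (d : EuclideanSpace ℝ (Fin n)) :
    D.smoothPart k θ (Function.update x i (x i + d)) ≤
      D.smoothPart k θ x + inner ℝ (blockGrad (D.smoothPart k θ) i x) d
        + (D.lam k * L i + G.degree i) / 2 * ‖d‖ ^ 2 := by
  rw [smoothPart_update hD.gram, hD.blockGrad_eq, inner_add_left, inner_smul_left, conj_trivial,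
    add_sub_cancel_left]
  have hγ := mul_le_mul_of_nonneg_left (le_add_inner_gradient_add_sq (hD.smooth i).differentiable
    (hD.smooth i).lipschitz (x i) d) (hD.lam_pos k).le
  linarith

theorem lam_mul_add_degree_pos [Nontrivial V] (hD : D.IsAdmissible G L τ) (k : ℕ) (i : V) :
    0 < D.lam k * L i + G.degree i := by
  have hdegree : 0 < G.degree i := hD.connected.preconnected.degree_pos_of_nontrivial i
  exact add_pos_of_nonneg_of_pos (mul_nonneg (hD.lam_pos k).le (L i).2) (by exact_mod_cast hdegree)

theorem isCompositeProblem [Nontrivial V] (hD : D.IsAdmissible G L τ) (k : ℕ)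
    (θ : EuclideanSpace ℝ κ) :
    IsCompositeProblem (fun i y => D.lam k * D.ρ i y) (D.smoothPart k θ)
      (fun i => D.lam k * L i + G.degree i) where
  convex i := (hD.nonsmooth i).convex.smul (hD.lam_pos k).le
  nonneg i x := mul_nonneg (hD.lam_pos k).le (hD.rho_nonneg i x)
  lip_pos := hD.lam_mul_add_degree_pos k
  linear_le := hD.smoothPart_linear_le k θ
  descent := hD.smoothPart_descent k θ

theorem nearMin_of_condA (hD : D.IsAdmissible G L τ) {k : ℕ} {θ : EuclideanSpace ℝ κ}
    {x : Blocks V n} (hx : D.CondA k θ x) : D.NearMin k θ x := by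
  obtain ⟨z, hz, hxz⟩ := hx
  intro w
  have hzw : D.subproblem k θ z ≤ D.subproblem k θ w := hz (Set.mem_univ w)
  have hslack : 0 ≤ D.xi k * ∑ i, ‖x i - w i‖ :=
    mul_nonneg (hD.xi_pos k).le (Finset.sum_nonneg fun i _ => norm_nonneg _)
  linarith

theorem nearMin_of_condB (hD : D.IsAdmissible G L τ) {k : ℕ} {θ : EuclideanSpace ℝ κ}
    {x : Blocks V n} (hx : D.CondB k θ x) : D.NearMin k θ x := by
  obtain ⟨g, hg, hnorm⟩ := hx
  choose q hq hgq using hg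
  intro w
  have := hD.nonempty
  have hxi (i : V) : ‖g i‖ ≤ D.xi k :=
    (hnorm i).trans <| div_le_self (hD.xi_pos k).le <| Real.one_le_sqrt.2 <| by
      exact_mod_cast Fintype.card_pos
  have hsmooth := hD.smoothPart_linear_le k θ x w
  have hnonsmooth : ∑ i, (D.lam k * D.ρ i (x i) + D.lam k * inner ℝ (q i) (w i - x i))
      ≤ ∑ i, D.lam k * D.ρ i (w i) := by
    simp only [← mul_add]
    exact Finset.sum_le_sum fun i _ => mul_le_mul_of_nonneg_left (hq i (w i)) (hD.lam_pos k).le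
  have hsplit : ∑ i, (D.lam k * inner ℝ (q i) (w i - x i)
      + inner ℝ (blockGrad (D.smoothPart k θ) i x) (w i - x i))
      = ∑ i, inner ℝ (g i) (w i - x i) := by
    simp only [hgq, inner_add_left, inner_smul_left, conj_trivial]
  have hcauchy : ∑ i, -inner ℝ (g i) (w i - x i) ≤ ∑ i, D.xi k * ‖x i - w i‖ := by
    refine Finset.sum_le_sum fun i _ => (neg_le_abs _).trans ?_
    rw [norm_sub_rev]
    exact (abs_real_inner_le_norm _ _).trans
      (mul_le_mul_of_nonneg_right (hxi i) (norm_nonneg _))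
  rw [Finset.sum_add_distrib] at hnonsmooth hsplit
  rw [Finset.sum_neg_distrib] at hcauchy
  simp only [subproblem, Finset.mul_sum]
  linarith [hD.alpha_pos k]

theorem nearMin_of_accepted (hD : D.IsAdmissible G L τ) {x : ℕ → Blocks V n} {k : ℕ}
    (hx : D.Accepted x k) : D.NearMin k (D.dual x k) (x (k + 1)) :=
  hx.elim hD.nearMin_of_condA hD.nearMin_of_condB

theorem norm_blockGrad_le_of_nearMin (hD : D.IsAdmissible G L τ) {k : ℕ}
    {θ : EuclideanSpace ℝ κ} {x : Blocks V n} (hx : D.NearMin k θ x) {i : V} {B s : ℝ}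
    (hB0 : 0 ≤ B) (hB : ∀ y, ∀ q ∈ subdiff (D.ρ i) y, ‖q‖ ≤ B) (hs : 0 < s) :
    ‖blockGrad (D.smoothPart k θ) i x‖ ≤ D.alpha k / s + (D.lam k * B + D.xi k)
      + (D.lam k * L i + G.degree i) / 2 * s := by
  have hlam := hD.lam_pos k
  refine norm_le_of_forall_neg_le (hD.alpha_pos k).le
    (add_nonneg (mul_nonneg hlam.le hB0) (hD.xi_pos k).le) (by positivity) hs fun d => ?_
  have hnear := hx (Function.update x i (x i + d))
  have hdescent := hD.smoothPart_descent k θ x i d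
  have hρ : ∑ j, D.ρ j (Function.update x i (x i + d) j)
      = ∑ j, D.ρ j (x j) + (D.ρ i (x i + d) - D.ρ i (x i)) := sum_update_apply D.ρ x i _
  have hdist : ∑ j, ‖x j - Function.update x i (x i + d) j‖ = ‖d‖ := by
    rw [sum_update_apply (fun j v => ‖x j - v‖) x i]
    simp
  have hlip : D.lam k * (D.ρ i (x i + d) - D.ρ i (x i)) ≤ D.lam k * (B * ‖d‖) := by
    have := sub_le_mul_norm_sub_of_subdiff_bounded (hD.nonsmooth i).convex hB (x i + d) (x i)
    rw [add_sub_cancel_left] at this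
    exact mul_le_mul_of_nonneg_left this hlam.le
  simp only [subproblem, hρ, hdist] at hnear
  linarith

-- With the displacement `s = c^k`, all three terms of `norm_blockGrad_le_of_nearMin` are `O(λ)`.
theorem exists_norm_gradient_sub_adjA_le (hD : D.IsAdmissible G L τ) :
    ∃ b : ℝ, 0 ≤ b ∧ ∀ k θ x, D.NearMin k θ x → ∀ i,
      ‖gradient (D.γ i) (x i) - D.adjA (θ - (D.lam k)⁻¹ • D.mulA x) i‖ ≤ b := by
  choose B hB0 hB using fun i => (hD.nonsmooth i).subdiff_bounded
  have hlam₁ := hD.lam₁_pos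
  have halpha₁ := hD.alpha₁_pos
  have hxi₁ := hD.xi₁_pos
  let e : V → ℝ := fun i => D.alpha₁ / D.lam₁ + B i + D.xi₁ / D.lam₁
    + (D.lam₁ * L i + G.degree i) / (2 * D.lam₁)
  have he : ∀ i, 0 ≤ e i := fun i => by have := hB0 i; positivity
  refine ⟨∑ i, e i, Finset.sum_nonneg fun i _ => he i, fun k θ x hx i => ?_⟩
  refine le_trans ?_ (Finset.single_le_sum (fun j _ => he j) (Finset.mem_univ i))
  have hlam := hD.lam_pos k
  have hck := pow_pos hD.c_pos k
  have halpha : D.alpha k / D.c ^ k = D.lam k * (D.alpha₁ / D.lam₁) := by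
    rw [hD.alpha_eq_lam_mul]; field_simp
  have hxi : D.xi k ≤ D.lam k * (D.xi₁ / D.lam₁) := by
    rw [hD.xi_eq_lam_mul]
    exact mul_le_mul_of_nonneg_left
      (mul_le_of_le_one_right (by positivity) (hD.c_pow_le_one k)) hlam.le
  have hquad : (D.lam k * L i + G.degree i) / 2 * D.c ^ k
      ≤ D.lam k * ((D.lam₁ * L i + G.degree i) / (2 * D.lam₁)) := by
    calc (D.lam k * L i + G.degree i) / 2 * D.c ^ k
        ≤ (D.lam₁ * L i + G.degree i) / 2 * D.c ^ k := by gcongr; exact hD.lam_le_lam₁ k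
      _ = D.lam k * ((D.lam₁ * L i + G.degree i) / (2 * D.lam₁)) := by rw [lam]; field_simp
  have hgrad := hD.norm_blockGrad_le_of_nearMin hx (hB0 i).le (hB i) hck
  rw [hD.blockGrad_eq_smul, norm_smul, Real.norm_of_nonneg hlam.le] at hgrad
  refine le_of_mul_le_mul_left (hgrad.trans ?_) hlam
  simp only [e]
  linarith

theorem cost_le_of_nearMin (hD : D.IsAdmissible G L τ) {k : ℕ} {θ : EuclideanSpace ℝ κ}
    {x w : Blocks V n} (hx : D.NearMin k θ x) (hw : D.mulA w = 0) :
    D.cost x ≤ D.cost w + D.lam k / 2 * ‖θ‖ ^ 2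
      + (D.alpha₁ / D.lam₁ + D.xi₁ / D.lam₁ * ∑ i, ‖x i - w i‖) * D.c ^ k := by
  have hlam := hD.lam_pos k
  have hnear := hx w
  rw [subproblem_eq_cost, subproblem_eq_cost, hw, zero_sub, norm_neg, norm_smul,
    Real.norm_of_nonneg hlam.le, hD.alpha_eq_lam_mul, hD.xi_eq_lam_mul] at hnear
  refine le_of_mul_le_mul_left ?_ hlam
  linarith [sq_nonneg ‖D.mulA x - D.lam k • θ‖]

theorem exists_mul_sum_norm_add_le (hD : D.IsAdmissible G L τ) {m : V → ℝ}
    (hm : ∀ i y, m i ≤ D.γ i y) :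
    ∃ δ C : ℝ, 0 < δ ∧ 0 ≤ C ∧ ∀ k θ x, D.NearMin k θ x →
      δ * ∑ i, ‖x i‖ + ∑ i, (D.γ i (x i) - m i) ≤ C + D.lam k / 2 * ‖θ‖ ^ 2 := by
  have := hD.nonempty
  obtain ⟨i₀, hi₀⟩ := Finite.exists_min τ
  have hlam₁ := hD.lam₁_pos
  have halpha₁ := hD.alpha₁_pos
  have hxi₁ := hD.xi₁_pos
  have hsum0 : 0 ≤ D.cost 0 - ∑ i, m i := by
    rw [cost, ← Finset.sum_sub_distrib]
    exact Finset.sum_nonneg fun i _ => by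
      linarith [hD.rho_nonneg i ((0 : Blocks V n) i), hm i ((0 : Blocks V n) i)]
  refine ⟨τ i₀ - D.xi₁ / D.lam₁, D.cost 0 - ∑ i, m i + D.alpha₁ / D.lam₁,
    sub_pos.2 (hD.xi₁_div_lam₁_lt i₀), by positivity, fun k θ x hx => ?_⟩
  have hcost := hD.cost_le_of_nearMin hx D.mulA_zero
  simp only [Pi.zero_apply, sub_zero] at hcost
  have hslack : (D.alpha₁ / D.lam₁ + D.xi₁ / D.lam₁ * ∑ i, ‖x i‖) * D.c ^ k
      ≤ D.alpha₁ / D.lam₁ + D.xi₁ / D.lam₁ * ∑ i, ‖x i‖ :=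
    mul_le_of_le_one_right (by positivity) (hD.c_pow_le_one k)
  have hcoercive : τ i₀ * ∑ i, ‖x i‖ ≤ ∑ i, D.ρ i (x i) := by
    rw [Finset.mul_sum]
    exact Finset.sum_le_sum fun i _ =>
      (mul_le_mul_of_nonneg_right (hi₀ i) (norm_nonneg _)).trans ((hD.nonsmooth i).coercive _)
  have hsplit : D.cost x = ∑ i, D.ρ i (x i) + ∑ i, D.γ i (x i) := Finset.sum_add_distrib
  rw [Finset.sum_sub_distrib]
  linarith

end IsAdmissible

end Data

/-! ### Rate of convergence of the outer iterations -/

section Recursion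

open Filter Topology

theorem exists_bound_of_le_add_mul {a : ℝ} {q : ℕ → ℝ} (ha : 0 ≤ a) (hq0 : ∀ j, 0 ≤ q j)
    (hq : Tendsto q atTop (𝓝 0)) :
    ∃ U : ℝ, ∀ (u : ℕ → ℝ) (k : ℕ), u 0 ≤ 0 →
      (∀ j < k, u (j + 1) ≤ a + q j * u j) → u k ≤ U := by
  let w : ℕ → ℝ := fun k => Nat.rec 0 (fun j wj => a + q j * wj) k
  have hw : ∀ j, w (j + 1) = a + q j * w j := fun j => rfl
  have hw0 : ∀ j, 0 ≤ w j := by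
    intro j
    induction j with
    | zero => exact le_rfl
    | succ j ih => rw [hw]; exact add_nonneg ha (mul_nonneg (hq0 j) ih)
  obtain ⟨K, hK⟩ := eventually_atTop.1 (hq.eventually_le_const (by norm_num : (0 : ℝ) < 1 / 2))
  have htail : ∀ j ≥ K, w j ≤ 2 * a + w K := by
    intro j hj
    induction j, hj using Nat.le_induction with
    | base => linarith
    | succ j hj ih =>
      have hhalf : q j * w j ≤ 1 / 2 * w j := mul_le_mul_of_nonneg_right (hK j hj) (hw0 j)
      rw [hw]
      linarith [hw0 K]
  obtain ⟨U, hU⟩ := (isBoundedUnder_of_eventually_le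
    (eventually_atTop.2 ⟨K, htail⟩)).bddAbove_range
  refine ⟨U, fun u k hu0 hu => le_trans ?_ (hU ⟨k, rfl⟩)⟩
  induction k with
  | zero => exact hu0
  | succ k ih =>
    exact (hu k k.lt_succ_self).trans <| add_le_add_right
      (mul_le_mul_of_nonneg_left (ih fun j hj => hu j (hj.trans k.lt_succ_self)) (hq0 k)) a

end Recursion

namespace Data

variable {V κ : Type*} [Fintype V] {n : ℕ}

theorem dual_mem_range (D : Data V κ n) (x : ℕ → Blocks V n) (k : ℕ) :
    D.dual x k ∈ LinearMap.range D.mulAₗ := by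
  induction k with
  | zero => exact Submodule.zero_mem _
  | succ k ih => exact Submodule.sub_mem _ ih (Submodule.smul_mem _ _ ⟨x (k + 1), rfl⟩)

variable [DecidableEq V] [Fintype κ]
  {G : SimpleGraph V} [DecidableRel G.Adj] {D : Data V κ n} {L : V → ℝ≥0} {τ : V → ℝ}

namespace IsAdmissible

theorem norm_gradient_sq_le_of_nearMin (hD : D.IsAdmissible G L τ) {δ C Λ : ℝ} {m : V → ℝ}
    (hδ : 0 ≤ δ) (hm : ∀ i y, m i ≤ D.γ i y) (hΛ : ∀ i, (L i : ℝ) ≤ Λ)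
    (hsum : ∀ k θ x, D.NearMin k θ x →
      δ * ∑ i, ‖x i‖ + ∑ i, (D.γ i (x i) - m i) ≤ C + D.lam k / 2 * ‖θ‖ ^ 2)
    {k : ℕ} {θ : EuclideanSpace ℝ κ} {x : Blocks V n} (hx : D.NearMin k θ x) (i : V) :
    ‖gradient (D.γ i) (x i)‖ ^ 2 ≤ 2 * Λ * C + Λ * D.lam k * ‖θ‖ ^ 2 := by
  have hΛ0 : 0 ≤ Λ := (L i).coe_nonneg.trans (hΛ i)
  have hgap (j : V) : 0 ≤ D.γ j (x j) - m j := sub_nonneg.2 (hm j _)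
  have hnorms : 0 ≤ δ * ∑ j, ‖x j‖ := mul_nonneg hδ (Finset.sum_nonneg fun j _ => norm_nonneg _)
  calc ‖gradient (D.γ i) (x i)‖ ^ 2 ≤ 2 * L i * (D.γ i (x i) - m i) :=
        norm_gradient_sq_le (hD.smooth i).differentiable (hD.smooth i).lipschitz (hm i) (x i)
    _ ≤ 2 * Λ * ∑ j, (D.γ j (x j) - m j) :=
        mul_le_mul (by linarith [hΛ i])
          (Finset.single_le_sum (fun j _ => hgap j) (Finset.mem_univ i)) (hgap i) (by positivity)
    _ ≤ 2 * Λ * (C + D.lam k / 2 * ‖θ‖ ^ 2) :=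
        mul_le_mul_of_nonneg_left (by linarith [hsum k θ x hx]) (by positivity)
    _ = 2 * Λ * C + Λ * D.lam k * ‖θ‖ ^ 2 := by ring

-- The dual vectors lie in the range of `A`, where they are controlled by `Aᵀ θ`. That vector is
-- within a constant of the gradients of the `γ i`, so `‖θ^(k+2)‖ ≤ a + b √c ^ k ‖θ^(k+1)‖`.
theorem exists_dual_bound (hD : D.IsAdmissible G L τ) :
    ∃ U : ℝ, ∀ (x : ℕ → Blocks V n) (k : ℕ),
      (∀ j < k, D.NearMin j (D.dual x j) (x (j + 1))) → ‖D.dual x k‖ ≤ U := by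
  choose m hm using fun i => (hD.smooth i).bddBelow
  obtain ⟨b, hb0, hb⟩ := hD.exists_norm_gradient_sub_adjA_le
  obtain ⟨δ, C, hδ, hC, hsum⟩ := hD.exists_mul_sum_norm_add_le hm
  obtain ⟨R, hR0, hR⟩ := D.exists_norm_le_of_mem_range
  obtain ⟨Λ, hΛ0, hΛ⟩ : ∃ Λ : ℝ, 0 ≤ Λ ∧ ∀ i, (L i : ℝ) ≤ Λ :=
    ⟨∑ i, (L i : ℝ), by positivity, fun i =>
      Finset.single_le_sum (f := fun i => (L i : ℝ)) (fun _ _ => by positivity)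
        (Finset.mem_univ i)⟩
  have hdecay : Filter.Tendsto (fun j => R * √(Λ * D.lam₁) * √D.c ^ j) Filter.atTop (nhds 0) := by
    simpa using (tendsto_pow_atTop_nhds_zero_of_lt_one (Real.sqrt_nonneg D.c)
      ((Real.sqrt_lt' one_pos).2 (by simpa using hD.c_lt_one))).const_mul (R * √(Λ * D.lam₁))
  obtain ⟨U, hU⟩ := exists_bound_of_le_add_mul (a := R * (√(2 * Λ * C) + b)) (by positivity)
    (fun j => by positivity) hdecay
  refine ⟨U, fun x k hx => hU (fun k => ‖D.dual x k‖) k (by simp [dual]) fun j hj => ?_⟩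
  have hgrad (i : V) : ‖gradient (D.γ i) (x (j + 1) i)‖
      ≤ √(2 * Λ * C) + √(Λ * D.lam₁) * √D.c ^ j * ‖D.dual x j‖ := by
    set r := √(Λ * D.lam₁) * √D.c ^ j * ‖D.dual x j‖ with hr
    have hr2 : r ^ 2 = Λ * D.lam j * ‖D.dual x j‖ ^ 2 := by
      rw [hr, mul_pow, mul_pow, Real.sq_sqrt (mul_nonneg hΛ0 hD.lam₁_pos.le), pow_right_comm,
        Real.sq_sqrt hD.c_pos.le, lam, mul_assoc Λ]
    have hcross : 0 ≤ √(2 * Λ * C) * r := by positivity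
    refine (pow_le_pow_iff_left₀ (norm_nonneg _) (by positivity) two_ne_zero).1 ?_
    rw [add_sq, Real.sq_sqrt (by positivity), hr2]
    linarith [hD.norm_gradient_sq_le_of_nearMin hδ.le hm hΛ hsum (hx j hj) i]
  have hadj (i : V) : ‖D.adjA (D.dual x (j + 1)) i‖
      ≤ √(2 * Λ * C) + √(Λ * D.lam₁) * √D.c ^ j * ‖D.dual x j‖ + b := by
    have hclose : ‖gradient (D.γ i) (x (j + 1) i) - D.adjA (D.dual x (j + 1)) i‖ ≤ b :=
      hb j _ _ (hx j hj) i
    linarith [hgrad i, norm_le_insert (gradient (D.γ i) (x (j + 1) i))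
      (D.adjA (D.dual x (j + 1)) i)]
  exact (hR _ (D.dual_mem_range x (j + 1)) _ (by positivity) hadj).trans_eq (by ring)

theorem exists_iterate_bound (hD : D.IsAdmissible G L τ) (U : ℝ) :
    ∃ R : ℝ, 0 ≤ R ∧ ∀ k θ x, ‖θ‖ ≤ U → D.NearMin k θ x → ∀ i, ‖x i‖ ≤ R := by
  choose m hm using fun i => (hD.smooth i).bddBelow
  obtain ⟨δ, C, hδ, hC, hsum⟩ := hD.exists_mul_sum_norm_add_le hm
  have hlam₁ := hD.lam₁_pos
  refine ⟨(C + D.lam₁ / 2 * U ^ 2) / δ, by positivity, fun k θ x hθ hx i => ?_⟩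
  have hgap : 0 ≤ ∑ j, (D.γ j (x j) - m j) := Finset.sum_nonneg fun j _ => sub_nonneg.2 (hm j _)
  have hnorm : δ * ‖x i‖ ≤ δ * ∑ j, ‖x j‖ := mul_le_mul_of_nonneg_left
    (Finset.single_le_sum (f := fun j => ‖x j‖) (fun j _ => norm_nonneg _) (Finset.mem_univ i))
    hδ.le
  have hdual : D.lam k / 2 * ‖θ‖ ^ 2 ≤ D.lam₁ / 2 * U ^ 2 := by
    have := hD.lam_le_lam₁ k
    gcongr
  rw [le_div_iff₀ hδ]
  linarith [hsum k θ x hx]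

theorem mulA_const (hD : D.IsAdmissible G L τ) (y : EuclideanSpace ℝ (Fin n)) :
    D.mulA (fun _ => y) = 0 := by
  simpa using norm_mulA_sq hD.gram fun _ => y

theorem exists_consensus_minimizer (hD : D.IsAdmissible G L τ) :
    ∃ y₀, IsMinOn (fun y => ∑ i, (D.ρ i y + D.γ i y)) Set.univ y₀ := by
  have := hD.nonempty
  have hρ := hD.continuous_rho
  have hγ := hD.continuous_gamma
  choose m hm using fun i => (hD.smooth i).bddBelow
  refine exists_isMinOn_of_coercive (a := ∑ i, τ i) (b := -∑ i, m i) (by fun_prop)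
    (Finset.sum_pos (fun i _ => (hD.nonsmooth i).tau_pos) Finset.univ_nonempty) fun y => ?_
  rw [sub_neg_eq_add, Finset.sum_mul, ← Finset.sum_add_distrib]
  exact Finset.sum_le_sum fun i _ => add_le_add ((hD.nonsmooth i).coercive y) (hm i y)

theorem norm_mulA_le_of_norm_dual_le (hD : D.IsAdmissible G L τ) {U : ℝ}
    {x : ℕ → Blocks V n} {k : ℕ} (hk : ‖D.dual x k‖ ≤ U) (hk' : ‖D.dual x (k + 1)‖ ≤ U) :
    ‖D.mulA (x (k + 1))‖ ≤ D.lam₁ * (2 * U) * D.c ^ k := by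
  have hlam := hD.lam_pos k
  calc ‖D.mulA (x (k + 1))‖ = ‖D.lam k • (D.dual x k - D.dual x (k + 1))‖ := by
        rw [dual, sub_sub_cancel, smul_inv_smul₀ hlam.ne']
    _ ≤ D.lam k * (U + U) := by
        rw [norm_smul, Real.norm_of_nonneg hlam.le]
        exact mul_le_mul_of_nonneg_left ((norm_sub_le _ _).trans (add_le_add hk hk')) hlam.le
    _ = D.lam₁ * (2 * U) * D.c ^ k := by rw [lam]; ring

theorem exists_cost_sub_const_le (hD : D.IsAdmissible G L τ) (U R : ℝ) (hR : 0 ≤ R)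
    (y : EuclideanSpace ℝ (Fin n)) :
    ∃ C : ℝ, 0 < C ∧ ∀ k θ x, ‖θ‖ ≤ U → (∀ i, ‖x i‖ ≤ R) → D.NearMin k θ x →
      D.cost x - D.cost (fun _ => y) ≤ C * D.c ^ k := by
  have hlam₁ := hD.lam₁_pos
  have halpha₁ := hD.alpha₁_pos
  have hxi₁ := hD.xi₁_pos
  refine ⟨D.lam₁ / 2 * U ^ 2
    + (D.alpha₁ / D.lam₁ + D.xi₁ / D.lam₁ * (Fintype.card V * (R + ‖y‖))), by positivity,
    fun k θ x hθ hRx hx => ?_⟩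
  have hck := (pow_pos hD.c_pos k).le
  have hdist : ∑ i, ‖x i - y‖ ≤ Fintype.card V * (R + ‖y‖) := by
    rw [← nsmul_eq_mul]
    exact Finset.sum_le_card_nsmul _ _ _ fun i _ =>
      (norm_sub_le _ _).trans (add_le_add_left (hRx i) _)
  have hdual : D.lam k / 2 * ‖θ‖ ^ 2 ≤ D.lam₁ / 2 * U ^ 2 * D.c ^ k := by
    calc D.lam k / 2 * ‖θ‖ ^ 2 ≤ D.lam k / 2 * U ^ 2 := by
          have := hD.lam_pos k
          gcongr
      _ = _ := by rw [lam]; ring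
  have hslack : (D.alpha₁ / D.lam₁ + D.xi₁ / D.lam₁ * ∑ i, ‖x i - y‖) * D.c ^ k
      ≤ (D.alpha₁ / D.lam₁ + D.xi₁ / D.lam₁ * (Fintype.card V * (R + ‖y‖))) * D.c ^ k := by
    gcongr
  linarith [hD.cost_le_of_nearMin hx (hD.mulA_const y)]

theorem exists_const_cost_sub_le (hD : D.IsAdmissible G L τ) {R : ℝ} (hR : 0 ≤ R) :
    ∃ C : ℝ, 0 ≤ C ∧ ∀ x : Blocks V n, (∀ i, ‖x i‖ ≤ R) → ∀ i₀,
      D.cost (fun _ => x i₀) - D.cost x ≤ C * ‖D.mulA x‖ := by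
  choose B hB0 hB using fun i => (hD.nonsmooth i).subdiff_bounded
  let S : V → ℝ := fun i => B i + (‖gradient (D.γ i) 0‖ + L i * R)
  have hS : ∀ i, 0 ≤ S i := fun i => by have := hB0 i; positivity
  refine ⟨∑ i, S i * Fintype.card V, Finset.sum_nonneg fun i _ => by have := hS i; positivity,
    fun x hx i₀ => ?_⟩
  rw [cost, cost, ← Finset.sum_sub_distrib, Finset.sum_mul]
  refine Finset.sum_le_sum fun i _ => ?_
  have hρ := sub_le_mul_norm_sub_of_subdiff_bounded (hD.nonsmooth i).convex (hB i) (x i₀) (x i)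
  have hγ := add_inner_gradient_le_of_convexOn (hD.smooth i).convex
    ((hD.smooth i).differentiable (x i₀)) (x i)
  have hgrad : ‖gradient (D.γ i) (x i₀)‖ ≤ ‖gradient (D.γ i) 0‖ + L i * R := by
    have hlip := (hD.smooth i).lipschitz.norm_sub_le (x i₀) 0
    rw [sub_zero] at hlip
    linarith [norm_sub_norm_le (gradient (D.γ i) (x i₀)) (gradient (D.γ i) 0),
      mul_le_mul_of_nonneg_left (hx i₀) (L i).coe_nonneg]
  have hcauchy : -inner ℝ (gradient (D.γ i) (x i₀)) (x i - x i₀)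
      ≤ (‖gradient (D.γ i) 0‖ + L i * R) * ‖x i₀ - x i‖ := by
    rw [norm_sub_rev]
    exact (neg_le_abs _).trans ((abs_real_inner_le_norm _ _).trans
      (mul_le_mul_of_nonneg_right hgrad (norm_nonneg _)))
  calc D.ρ i (x i₀) + D.γ i (x i₀) - (D.ρ i (x i) + D.γ i (x i)) ≤ S i * ‖x i₀ - x i‖ := by
        simp only [S]
        linarith
    _ ≤ S i * (Fintype.card V * ‖D.mulA x‖) :=
        mul_le_mul_of_nonneg_left (norm_sub_le_card_mul hD.gram hD.connected x i₀ i) (hS i)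
    _ = S i * Fintype.card V * ‖D.mulA x‖ := (mul_assoc _ _ _).symm

theorem exists_rate (hD : D.IsAdmissible G L τ) :
    ∃ C : ℝ, 0 < C ∧ ∀ (x : ℕ → Blocks V n) (k : ℕ),
      (∀ j < k + 1, D.NearMin j (D.dual x j) (x (j + 1))) →
      D.EpsOptimal (C * D.c ^ k) (x (k + 1)) ∧ EpsFeasible G (C * D.c ^ k) (x (k + 1)) := by
  obtain ⟨i₀⟩ := hD.nonempty
  obtain ⟨U, hU⟩ := hD.exists_dual_bound
  obtain ⟨R, hR0, hR⟩ := hD.exists_iterate_bound U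
  obtain ⟨y₀, hy₀⟩ := hD.exists_consensus_minimizer
  obtain ⟨C₁, hC₁, hupper⟩ := hD.exists_cost_sub_const_le U R hR0 y₀
  obtain ⟨C₂, hC₂, hlower⟩ := hD.exists_const_cost_sub_le hR0
  have hU0 : 0 ≤ U := (norm_nonneg _).trans (hU 0 0 (by simp))
  set C₃ := D.lam₁ * (2 * U)
  have hC₃ : 0 ≤ C₃ := mul_nonneg hD.lam₁_pos.le (by positivity)
  refine ⟨C₁ + C₂ * C₃ + C₃, by positivity, fun x k hx => ?_⟩
  have hck := pow_pos hD.c_pos k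
  have hdual := hU x k fun j hj => hx j (by omega)
  have hnear := hx k k.lt_succ_self
  have hbound := hR k _ _ hdual hnear
  have hA := hD.norm_mulA_le_of_norm_dual_le hdual (hU x (k + 1) hx)
  have hmin (y) : D.cost (fun _ => y₀) ≤ D.cost fun _ => y := hy₀ (Set.mem_univ y)
  have hinf : (⨅ y, ∑ i, (D.ρ i y + D.γ i y)) = D.cost fun _ => y₀ :=
    le_antisymm (ciInf_le ⟨_, Set.forall_mem_range.2 hmin⟩ y₀) (le_ciInf hmin)
  have hC₁k : 0 ≤ C₁ * D.c ^ k := by positivity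
  have hC₂k : 0 ≤ C₂ * C₃ * D.c ^ k := by positivity
  have hC₃k : 0 ≤ C₃ * D.c ^ k := by positivity
  constructor
  · have hconsensus : D.cost (fun _ => x (k + 1) i₀) - D.cost (x (k + 1))
        ≤ C₂ * (C₃ * D.c ^ k) :=
      (hlower _ hbound i₀).trans (mul_le_mul_of_nonneg_left hA hC₂)
    change |D.cost (x (k + 1)) - _| ≤ _
    rw [hinf, abs_le]
    constructor
    · linarith [hmin (x (k + 1) i₀)]
    · linarith [hupper k _ _ hdual hbound hnear]
  · intro i j hij
    linarith [norm_sub_le_norm_mulA hD.gram (x (k + 1)) hij]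

end IsAdmissible

end Data

/-! ### Success probability of the asynchronous method -/

section Probability

theorem setOf_forall_lt_succ {Ω : Type*} (A : ℕ → Set Ω) (k : ℕ) :
    {ω | ∀ j < k + 1, ω ∈ A j} = {ω | ∀ j < k, ω ∈ A j} ∩ A k := by
  ext ω
  simp only [Set.mem_ofPred_eq, Set.mem_inter_iff, Nat.forall_lt_succ_right]

variable {Ω : Type*} [MeasurableSpace Ω] {μ : Measure Ω} {A : ℕ → Set Ω}

theorem measurableSet_setOf_forall_lt (hA : ∀ k, MeasurableSet (A k)) (k : ℕ) :
    MeasurableSet {ω | ∀ j < k, ω ∈ A j} := by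
  simp only [Set.ofPred_forall]
  exact .iInter fun j => .iInter fun _ => hA j

theorem measureReal_cond_mul [IsFiniteMeasure μ] (hA : ∀ k, MeasurableSet (A k)) (k : ℕ) :
    (ProbabilityTheory.cond μ {ω | ∀ j < k, ω ∈ A j}).real (A k)
      * μ.real {ω | ∀ j < k, ω ∈ A j} = μ.real {ω | ∀ j < k + 1, ω ∈ A j} := by
  rw [setOf_forall_lt_succ, Measure.real, Measure.real, Measure.real,
    ← cond_mul_eq_inter (measurableSet_setOf_forall_lt hA k) _ μ, ENNReal.toReal_mul]

theorem pow_le_measureReal_of_le_cond [IsProbabilityMeasure μ] (hA : ∀ k, MeasurableSet (A k))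
    {q : ℝ} (hq : 0 ≤ q) {M : ℕ}
    (h : ∀ k < M, q ≤ (ProbabilityTheory.cond μ {ω | ∀ j < k, ω ∈ A j}).real (A k)) :
    q ^ M ≤ μ.real {ω | ∀ j < M, ω ∈ A j} := by
  induction M with
  | zero => simp
  | succ M ih =>
    rw [← measureReal_cond_mul hA, pow_succ']
    exact mul_le_mul (h M M.lt_succ_self) (ih fun k hk => h k (hk.trans M.lt_succ_self))
      (pow_nonneg hq M) measureReal_nonneg

end Probability

section Closed

theorem isClosed_setOf_exists_mem_of_isCompact {X Y : Type*} [TopologicalSpace X]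
    [TopologicalSpace Y] {K : Set X} (hK : IsCompact K) {C : Set (X × Y)} (hC : IsClosed C) :
    IsClosed {y | ∃ x ∈ K, (x, y) ∈ C} := by
  have := isCompact_iff_compactSpace.1 hK
  have hpre : IsClosed {s : K × Y | ((s.1 : X), s.2) ∈ C} := hC.preimage (by fun_prop)
  convert isClosedMap_snd_of_compactSpace _ hpre using 1
  ext y
  simp

theorem isClosed_setOf_mem_subdiff {n : ℕ} {ρ : EuclideanSpace ℝ (Fin n) → ℝ}
    (hρ : Continuous ρ) :
    IsClosed {p : EuclideanSpace ℝ (Fin n) × EuclideanSpace ℝ (Fin n) |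
      p.1 ∈ subdiff ρ p.2} := by
  have hset : {p : EuclideanSpace ℝ (Fin n) × EuclideanSpace ℝ (Fin n) | p.1 ∈ subdiff ρ p.2}
      = ⋂ y, {p | ρ p.2 + inner ℝ p.1 (y - p.2) ≤ ρ y} := by
    ext p
    simp only [subdiff, Set.mem_ofPred_eq, Set.mem_iInter]
  rw [hset]
  exact isClosed_iInter fun y => isClosed_le (by fun_prop) continuous_const

end Closed

namespace Data

theorem one_le_outerIters {V κ : Type*} {n : ℕ} (D : Data V κ n) (C ε : ℝ) :
    1 ≤ D.outerIters C ε :=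
  le_max_left _ _

variable {V κ : Type*} [Fintype V] {n : ℕ} {D : Data V κ n}

theorem measurable_dual [Finite κ] (D : Data V κ n) {Ω : Type*} [MeasurableSpace Ω]
    {x : ℕ → Ω → Blocks V n} (hx : ∀ k, Measurable (x k)) (k : ℕ) :
    Measurable fun ω => D.dual (fun l => x l ω) k := by
  have := Fintype.ofFinite κ
  induction k with
  | zero => exact measurable_const
  | succ k ih =>
    exact ih.sub ((D.continuous_mulA.measurable.comp (hx (k + 1))).const_smul (D.lam k)⁻¹)

variable [DecidableEq V] [Fintype κ] {G : SimpleGraph V} [DecidableRel G.Adj] {L : V → ℝ≥0}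
  {τ : V → ℝ}

theorem condB_iff {k : ℕ} {θ : EuclideanSpace ℝ κ} {x : Blocks V n} :
    D.CondB k θ x ↔ ∀ i, ∃ q ∈ subdiff (D.ρ i) (x i),
      ‖D.lam k • q + blockGrad (D.smoothPart k θ) i x‖ ≤ D.xi k / √(Fintype.card V : ℝ) := by
  constructor
  · rintro ⟨g, hg, hle⟩ i
    obtain ⟨q, hq, hgq⟩ := hg i
    exact ⟨q, hq, hgq ▸ hle i⟩
  · intro h
    choose q hq hle using h
    exact ⟨_, fun i => ⟨q i, hq i, rfl⟩, hle⟩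

namespace IsAdmissible

theorem continuous_subproblem (hD : D.IsAdmissible G L τ) (k : ℕ) :
    Continuous fun p : EuclideanSpace ℝ κ × Blocks V n => D.subproblem k p.1 p.2 := by
  have hγ := hD.continuous_gamma
  have hρ := hD.continuous_rho
  have hA := D.continuous_mulA
  unfold subproblem smoothPart
  fun_prop

theorem exists_isMinOn_subproblem (hD : D.IsAdmissible G L τ) (k : ℕ)
    (θ : EuclideanSpace ℝ κ) : ∃ xs, IsMinOn (D.subproblem k θ) Set.univ xs := by
  have := hD.nonempty
  obtain ⟨i₀, hi₀⟩ := Finite.exists_min τ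
  choose m hm using fun i => (hD.smooth i).bddBelow
  have hlam := hD.lam_pos k
  have hτ := (hD.nonsmooth i₀).tau_pos
  refine exists_isMinOn_of_coercive (a := D.lam k * τ i₀) (b := -(D.lam k * ∑ i, m i))
    ((hD.continuous_subproblem k).comp (by fun_prop : Continuous fun x => (θ, x)))
    (mul_pos hlam hτ) fun x => ?_
  have hnorm : ‖x‖ ≤ ∑ i, ‖x i‖ :=
    (pi_norm_le_iff_of_nonneg (Finset.sum_nonneg fun i _ => norm_nonneg _)).2 fun i =>
      Finset.single_le_sum (f := fun i => ‖x i‖) (fun i _ => norm_nonneg _) (Finset.mem_univ i)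
  have hρ : τ i₀ * ‖x‖ ≤ ∑ i, D.ρ i (x i) := by
    refine (mul_le_mul_of_nonneg_left hnorm hτ.le).trans ?_
    rw [Finset.mul_sum]
    exact Finset.sum_le_sum fun i _ =>
      (mul_le_mul_of_nonneg_right (hi₀ i) (norm_nonneg _)).trans ((hD.nonsmooth i).coercive _)
  have hγ : ∑ i, m i ≤ ∑ i, D.γ i (x i) := Finset.sum_le_sum fun i _ => hm i _
  have hsum := mul_le_mul_of_nonneg_left (add_le_add hρ hγ) hlam.le
  have hpenalty := sq_nonneg ‖D.mulA x - D.lam k • θ‖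
  simp only [subproblem, smoothPart]
  linarith

theorem condA_iff (hD : D.IsAdmissible G L τ) {k : ℕ} {θ : EuclideanSpace ℝ κ}
    {x : Blocks V n} :
    D.CondA k θ x ↔ ∀ w, D.subproblem k θ x ≤ D.subproblem k θ w + D.alpha k := by
  constructor
  · rintro ⟨xs, hxs, hle⟩ w
    have hmin : D.subproblem k θ xs ≤ D.subproblem k θ w := hxs (Set.mem_univ w)
    linarith
  · intro h
    obtain ⟨xs, hxs⟩ := hD.exists_isMinOn_subproblem k θ
    exact ⟨xs, hxs, by linarith [h xs]⟩

theorem isClosed_setOf_condA (hD : D.IsAdmissible G L τ) (k : ℕ) :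
    IsClosed {p : EuclideanSpace ℝ κ × Blocks V n | D.CondA k p.1 p.2} := by
  simp only [hD.condA_iff, Set.ofPred_forall]
  have hP := hD.continuous_subproblem k
  have hPw (w : Blocks V n) : Continuous fun p : EuclideanSpace ℝ κ × Blocks V n =>
      D.subproblem k p.1 w :=
    hP.comp (by fun_prop : Continuous fun p : EuclideanSpace ℝ κ × Blocks V n => (p.1, w))
  exact isClosed_iInter fun w => isClosed_le hP ((hPw w).add continuous_const)

theorem continuous_blockGrad_smoothPart (hD : D.IsAdmissible G L τ) (k : ℕ) (i : V) :
    Continuous fun p : EuclideanSpace ℝ κ × Blocks V n =>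
      blockGrad (D.smoothPart k p.1) i p.2 := by
  simp only [hD.blockGrad_eq]
  have hγ := (hD.smooth i).lipschitz.continuous
  have hA := D.continuous_mulA
  have hadj : Continuous fun r => D.adjA r i :=
    (continuous_apply i).comp D.adjA.continuous_of_finiteDimensional
  have hres : Continuous fun p : EuclideanSpace ℝ κ × Blocks V n =>
      D.mulA p.2 - D.lam k • p.1 := by fun_prop
  have hlocal : Continuous fun p : EuclideanSpace ℝ κ × Blocks V n =>
      D.lam k • gradient (D.γ i) (p.2 i) := by fun_prop
  exact hlocal.add (hadj.comp hres)

theorem isClosed_setOf_condB (hD : D.IsAdmissible G L τ) (k : ℕ) :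
    IsClosed {p : EuclideanSpace ℝ κ × Blocks V n | D.CondB k p.1 p.2} := by
  simp only [condB_iff, Set.ofPred_forall]
  refine isClosed_iInter fun i => ?_
  obtain ⟨B, -, hB⟩ := (hD.nonsmooth i).subdiff_bounded
  have hgrad := hD.continuous_blockGrad_smoothPart k i
  have hsubdiff : IsClosed {s : EuclideanSpace ℝ (Fin n) × EuclideanSpace ℝ κ × Blocks V n |
      s.1 ∈ subdiff (D.ρ i) (s.2.2 i)} :=
    (isClosed_setOf_mem_subdiff (hD.continuous_rho i)).preimage
      (by fun_prop : Continuous fun s : EuclideanSpace ℝ (Fin n) × EuclideanSpace ℝ κ ×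
        Blocks V n => (s.1, s.2.2 i))
  have hnorm : IsClosed {s : EuclideanSpace ℝ (Fin n) × EuclideanSpace ℝ κ × Blocks V n |
      ‖D.lam k • s.1 + blockGrad (D.smoothPart k s.2.1) i s.2.2‖
        ≤ D.xi k / √(Fintype.card V : ℝ)} :=
    isClosed_le ((continuous_fst.const_smul (D.lam k)).add (hgrad.comp continuous_snd)).norm
      continuous_const
  convert isClosed_setOf_exists_mem_of_isCompact (isCompact_closedBall 0 B)
    (hsubdiff.inter hnorm) using 1
  ext p
  exact exists_congr fun q => ⟨fun h => ⟨mem_closedBall_zero_iff.2 (hB _ q h.1), h⟩, And.right⟩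

theorem measurableSet_accepted (hD : D.IsAdmissible G L τ) {Ω : Type*} [MeasurableSpace Ω]
    {x : ℕ → Ω → Blocks V n} (hx : ∀ k, Measurable (x k)) (k : ℕ) :
    MeasurableSet {ω | D.Accepted (fun l => x l ω) k} := by
  have hpair : Measurable fun ω => (D.dual (fun l => x l ω) k, x (k + 1) ω) :=
    (D.measurable_dual hx k).prodMk (hx (k + 1))
  exact (hpair (hD.isClosed_setOf_condA k).measurableSet).union
    (hpair (hD.isClosed_setOf_condB k).measurableSet)

theorem pow_outerIters_le (hD : D.IsAdmissible G L τ) {C ε : ℝ} (hC : 0 < C) (hε : 0 < ε) :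
    D.c ^ D.outerIters C ε ≤ ε / C := by
  have hc := hD.c_pos
  have hlog : Real.logb (1 / D.c) (C / ε) ≤ D.outerIters C ε :=
    (Nat.le_ceil _).trans (by exact_mod_cast le_max_right _ _)
  rw [Real.logb_le_iff_le_rpow (one_lt_one_div hc hD.c_lt_one) (by positivity),
    Real.rpow_natCast, one_div, inv_pow] at hlog
  simpa only [inv_inv, inv_div] using inv_anti₀ (by positivity) hlog

theorem async_guarantee (hD : D.IsAdmissible G L τ) {C : ℝ} (hC : 0 < C)
    (hrate : ∀ (x : ℕ → Blocks V n) (k : ℕ),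
      (∀ j < k + 1, D.NearMin j (D.dual x j) (x (j + 1))) →
      D.EpsOptimal (C * D.c ^ k) (x (k + 1)) ∧ EpsFeasible G (C * D.c ^ k) (x (k + 1)))
    {ε : ℝ} (hε : 0 < ε) {p : ℝ} (hp1 : p < 1)
    {Ω : Type*} [MeasurableSpace Ω] (μ : Measure Ω) [IsProbabilityMeasure μ]
    {x : ℕ → Ω → Blocks V n} (hx : ∀ k, Measurable (x k))
    (hacc : D.AsyncAccepted μ x (D.outerIters (C / D.c) ε) p) :
    1 - p ≤ μ.real {ω | D.EpsOptimal ε (x (D.outerIters (C / D.c) ε) ω) ∧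
      EpsFeasible G ε (x (D.outerIters (C / D.c) ε) ω)} := by
  have hc := hD.c_pos
  have hpow := hD.pow_outerIters_le (C := C / D.c) (by positivity) hε
  obtain ⟨k, hk⟩ := Nat.exists_eq_add_of_le' (D.one_le_outerIters (C / D.c) ε)
  rw [hk] at hpow hacc ⊢
  have hCk : C * D.c ^ k ≤ ε := by
    rw [pow_succ, div_div_eq_mul_div, le_div_iff₀ hC] at hpow
    exact le_of_mul_le_mul_right (by linarith) hc
  have hprob := pow_le_measureReal_of_le_cond (fun k => hD.measurableSet_accepted hx k)
    (Real.rpow_nonneg (by linarith : 0 ≤ 1 - p) (1 / ((k + 1 : ℕ) : ℝ))) hacc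
  rw [← Real.rpow_natCast, ← Real.rpow_mul (by linarith), one_div,
    inv_mul_cancel₀ (by positivity), Real.rpow_one] at hprob
  refine hprob.trans (measureReal_mono fun ω hω => ?_)
  obtain ⟨hopt, hfeas⟩ := hrate (fun l => x l ω) k fun j hj => hD.nearMin_of_accepted (hω j hj)
  exact ⟨hopt.trans hCk, fun i j hij => (hfeas i j hij).trans hCk⟩

end IsAdmissible

end Data

/-! ### Repeated randomized calls -/

section Probability

variable {Ω : Type*} [MeasurableSpace Ω] {μ : Measure Ω}

theorem le_measureReal_cond_of_measureReal_sdiff_le [IsProbabilityMeasure μ] {A : ℕ → Set Ω}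
    (hA : ∀ k, MeasurableSet (A k)) {q : ℝ} (hq : 0 < q) {M : ℕ}
    (h : ∀ k < M, μ.real ({ω | ∀ j < k, ω ∈ A j} \ A k)
      ≤ (1 - q) * μ.real {ω | ∀ j < k, ω ∈ A j}) {k : ℕ} (hk : k < M) :
    q ≤ (ProbabilityTheory.cond μ {ω | ∀ j < k, ω ∈ A j}).real (A k) := by
  have hstep (k : ℕ) (hk : k < M) :
      q * μ.real {ω | ∀ j < k, ω ∈ A j} ≤ μ.real {ω | ∀ j < k + 1, ω ∈ A j} := by
    have hsplit := measureReal_inter_add_sdiff (μ := μ) (s := {ω | ∀ j < k, ω ∈ A j}) (hA k)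
    rw [setOf_forall_lt_succ]
    linarith [h k hk]
  have hpos (k : ℕ) (hk : k ≤ M) : 0 < μ.real {ω | ∀ j < k, ω ∈ A j} := by
    induction k with
    | zero => simp
    | succ k ih => exact (mul_pos hq (ih (by omega))).trans_le (hstep k hk)
  refine le_of_mul_le_mul_right ?_ (hpos k hk.le)
  rw [measureReal_cond_mul hA]
  exact hstep k hk

theorem measureReal_mem_and_mem_le_of_indepFun [IsFiniteMeasure μ] {α β : Type*} [Finite α]
    [MeasurableSpace α] [MeasurableSpace β] [DiscreteMeasurableSpace α]
    [DiscreteMeasurableSpace β] {Q : Ω → α} {B : Ω → β} (hQ : Measurable Q)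
    (hind : IndepFun Q B μ) {S : Set α} {Bad : α → Set β} {δ : ℝ}
    (h : ∀ q ∈ S, μ.real {ω | B ω ∈ Bad q} ≤ δ) :
    μ.real {ω | Q ω ∈ S ∧ B ω ∈ Bad (Q ω)} ≤ δ * μ.real {ω | Q ω ∈ S} := by
  classical
  have := Fintype.ofFinite α
  have hcover : {ω | Q ω ∈ S ∧ B ω ∈ Bad (Q ω)} ⊆
      ⋃ q ∈ S.toFinset, (Q ⁻¹' {q} ∩ B ⁻¹' Bad q) := by
    intro ω hω
    simp only [Set.mem_iUnion, Set.mem_toFinset]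
    exact ⟨Q ω, hω.1, rfl, hω.2⟩
  have hpreimage : {ω | Q ω ∈ S} = Q ⁻¹' (S.toFinset : Set α) := by ext; simp
  have hprod (q : α) :
      μ.real (Q ⁻¹' {q} ∩ B ⁻¹' Bad q) = μ.real (Q ⁻¹' {q}) * μ.real (B ⁻¹' Bad q) := by
    simp only [Measure.real, ← ENNReal.toReal_mul]
    rw [hind.measure_inter_preimage_eq_mul _ _ .of_discrete .of_discrete]
  rw [hpreimage, ← sum_measureReal_preimage_singleton _ fun y _ => hQ (.singleton y),
    Finset.mul_sum]
  refine (measureReal_mono hcover (measure_ne_top _ _)).trans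
    ((measureReal_biUnion_finset_le _ _).trans (Finset.sum_le_sum fun q hq => ?_))
  rw [hprod, mul_comm]
  exact mul_le_mul_of_nonneg_right (h q (Set.mem_toFinset.1 hq)) measureReal_nonneg

variable {V : Type*} [Fintype V] [MeasurableSpace V] [DiscreteMeasurableSpace V]

theorem measureReal_eq_of_uniform {ι : Type*} [Fintype ι] {f : ι → Ω → V} (hf : iIndepFun f μ)
    (hunif : ∀ s i, μ.real {ω | f s ω = i} = 1 / (Fintype.card V : ℝ)) (h : ι → V) :
    μ.real {ω | ∀ s, f s ω = h s} = (1 / (Fintype.card V : ℝ)) ^ Fintype.card ι := by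
  have hset : {ω | ∀ s, f s ω = h s} = ⋂ s ∈ (Finset.univ : Finset ι), f s ⁻¹' {h s} := by
    ext ω
    simp only [Set.mem_ofPred_eq, Finset.mem_univ, Set.iInter_true, Set.mem_iInter,
      Set.mem_preimage, Set.mem_singleton_iff]
  have hfactor (s : ι) : (μ (f s ⁻¹' {h s})).toReal = 1 / (Fintype.card V : ℝ) := hunif s _
  rw [hset, Measure.real, hf.measure_inter_preimage_eq_mul _ fun _ _ => .of_discrete,
    ENNReal.toReal_prod]
  simp only [hfactor, Finset.prod_const, Finset.card_univ]

theorem measureReal_forall_mem_le_of_uniform [IsFiniteMeasure μ] [Nonempty V] {ι β : Type*}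
    [Fintype ι] [Fintype β] {f : ι → β → Ω → V} (hm : ∀ r l, Measurable (f r l))
    (hf : iIndepFun (fun s : ι × β => f s.1 s.2) μ)
    (hunif : ∀ r l i, μ.real {ω | f r l ω = i} = 1 / (Fintype.card V : ℝ))
    {Bad : Finset (β → V)}
    (hBad : 2 * (Bad.card : ℝ) ≤ (Fintype.card V : ℝ) ^ Fintype.card β) :
    μ.real {ω | ∀ r, (fun l => f r l ω) ∈ Bad} ≤ (1 / 2) ^ Fintype.card ι := by
  classical
  have hmeas : Measurable fun ω r l => f r l ω :=
    measurable_pi_lambda _ fun r => measurable_pi_lambda _ fun l => hm r l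
  have hpreimage : {ω | ∀ r, (fun l => f r l ω) ∈ Bad}
      = (fun ω r l => f r l ω) ⁻¹' (Fintype.piFinset fun _ : ι => Bad : Set _) := by
    ext ω
    simp
  have hpoint (h : ι → β → V) : μ.real ((fun ω r l => f r l ω) ⁻¹' {h})
      = (1 / (Fintype.card V : ℝ)) ^ (Fintype.card β * Fintype.card ι) := by
    rw [mul_comm, ← Fintype.card_prod,
      ← measureReal_eq_of_uniform hf (fun s => hunif s.1 s.2) fun s => h s.1 s.2]
    congr 1
    ext ω
    simp only [Set.mem_preimage, Set.mem_singleton_iff, funext_iff, Set.mem_ofPred_eq,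
      Prod.forall]
  have hfrac : Bad.card * (1 / (Fintype.card V : ℝ)) ^ Fintype.card β ≤ 1 / 2 := by
    rw [one_div, inv_pow, ← div_eq_mul_inv, div_le_div_iff₀ (by positivity) two_pos]
    linarith
  rw [hpreimage, ← sum_measureReal_preimage_singleton _ fun y _ => hmeas (.singleton y)]
  simp only [hpoint, Finset.sum_const, Fintype.card_piFinset, Finset.prod_const,
    Finset.card_univ, nsmul_eq_mul, Nat.cast_pow, pow_mul, ← mul_pow]
  exact pow_le_pow_left₀ (by positivity) hfrac _

end Probability

theorem bestOf_le {X : Type*} (Φ : X → ℝ) (y : ℕ → X) {K r : ℕ} (hr : r ≤ K) :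
    Φ (bestOf Φ y K) ≤ Φ (y r) := by
  induction K with
  | zero => rw [Nat.le_zero.1 hr, bestOf]
  | succ K ih =>
    rw [bestOf]
    rcases Nat.le_succ_iff.1 hr with hr | rfl
    · split_ifs with hlt
      · exact hlt.le.trans (ih hr)
      · exact ih hr
    · split_ifs with hlt
      · exact le_rfl
      · exact not_lt.1 hlt

theorem bestOf_congr {X : Type*} (Φ : X → ℝ) {y y' : ℕ → X} {K : ℕ} (h : ∀ r ≤ K, y r = y' r) :
    bestOf Φ y K = bestOf Φ y' K := by
  induction K with
  | zero => exact h 0 le_rfl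
  | succ K ih =>
    simp only [bestOf]
    rw [ih fun r hr => h r (by omega), h (K + 1) le_rfl]

section Samples

/-- The indices `(j, r, l)` of the nodes drawn in outer iteration `j = k`. -/
def sampleBlock (K T : ℕ → ℕ) (k : ℕ) : Finset (ℕ × ℕ × ℕ) :=
  {k} ×ˢ Finset.range (K k + 1) ×ˢ Finset.range (T k + 1)

/-- The indices `(j, r, l)` of the nodes drawn before outer iteration `k`. -/
def samplePast (K T : ℕ → ℕ) (k : ℕ) : Finset (ℕ × ℕ × ℕ) :=
  (Finset.range k).biUnion (sampleBlock K T)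

theorem mem_sampleBlock {K T : ℕ → ℕ} {k j r l : ℕ} :
    (j, r, l) ∈ sampleBlock K T k ↔ j = k ∧ r < K k + 1 ∧ l < T k + 1 := by
  simp only [sampleBlock, Finset.mem_product, Finset.mem_singleton, Finset.mem_range]

theorem mem_samplePast {K T : ℕ → ℕ} {k j r l : ℕ} :
    (j, r, l) ∈ samplePast K T k ↔ j < k ∧ r < K j + 1 ∧ l < T j + 1 := by
  simp only [samplePast, Finset.mem_biUnion, Finset.mem_range, mem_sampleBlock]
  constructor
  · rintro ⟨_, hj, rfl, hrl⟩
    exact ⟨hj, hrl⟩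
  · rintro ⟨hj, hrl⟩
    exact ⟨j, hj, rfl, hrl⟩

theorem disjoint_samplePast_sampleBlock (K T : ℕ → ℕ) (k : ℕ) :
    Disjoint (samplePast K T k) (sampleBlock K T k) := by
  rw [Finset.disjoint_left]
  rintro ⟨j, r, l⟩ hpast hblock
  exact (mem_samplePast.1 hpast).1.ne (mem_sampleBlock.1 hblock).1

variable {V : Type*}

/-- The nodes drawn before outer iteration `k`, as a function on a finite index set: all events
about them are then measurable. -/
def pastSamples (K T : ℕ → ℕ) (k : ℕ) (R : ℕ → ℕ → ℕ → V) : samplePast K T k → V :=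
  fun s => R s.1.1 s.1.2.1 s.1.2.2

/-- Extension of nodes given on a finite index set to all indices, with an arbitrary node where
none is given. -/
noncomputable def extendSamples [Nonempty V] {S : Finset (ℕ × ℕ × ℕ)} (h : S → V) (j r l : ℕ) : V :=
  if hm : (j, r, l) ∈ S then h ⟨(j, r, l), hm⟩ else Classical.arbitrary V

theorem extendSamples_pastSamples [Nonempty V] {K T : ℕ → ℕ} {k j r l : ℕ} (R : ℕ → ℕ → ℕ → V)
    (hj : j < k) (hr : r < K j + 1) (hl : l < T j + 1) :
    extendSamples (pastSamples K T k R) j r l = R j r l := by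
  rw [extendSamples, dif_pos (mem_samplePast.2 ⟨hj, hr, hl⟩), pastSamples]

variable [MeasurableSpace V] {Ω : Type*} [MeasurableSpace Ω] {R : Ω → ℕ → ℕ → ℕ → V}

theorem measurable_pastSamples (hm : ∀ k r l, Measurable fun ω => R ω k r l) (K T : ℕ → ℕ)
    (k : ℕ) : Measurable fun ω => pastSamples K T k (R ω) :=
  measurable_pi_lambda _ fun _ => hm _ _ _

theorem indepFun_pastSamples {μ : Measure Ω} (hm : ∀ k r l, Measurable fun ω => R ω k r l)
    (hind : iIndepFun (fun (s : ℕ × ℕ × ℕ) ω => R ω s.1 s.2.1 s.2.2) μ) (K T : ℕ → ℕ) (k : ℕ) :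
    IndepFun (fun ω => pastSamples K T k (R ω))
      (fun ω (r : Fin (K k + 1)) (l : Fin (T k + 1)) => R ω k r l) μ := by
  have hmem (r : Fin (K k + 1)) (l : Fin (T k + 1)) :
      (k, (r : ℕ), (l : ℕ)) ∈ sampleBlock K T k := mem_sampleBlock.2 ⟨rfl, r.2, l.2⟩
  have hblocks := hind.indepFun_finset _ _ (disjoint_samplePast_sampleBlock K T k)
    fun s => hm s.1 s.2.1 s.2.2
  exact hblocks.comp (φ := id) (ψ := fun (h : sampleBlock K T k → V) (r : Fin (K k + 1))
    (l : Fin (T k + 1)) => h ⟨(k, r, l), hmem r l⟩) measurable_id <|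
    measurable_pi_lambda _ fun _ => measurable_pi_lambda _ fun _ => measurable_pi_apply _

end Samples

namespace Data

variable {V κ : Type*} [Fintype V] [DecidableEq V] [Fintype κ] {n : ℕ}

theorem arbcdRun_congr (D : Data V κ n) (Lip : ℕ → V → ℝ) (K T : ℕ → ℕ) (x0 : Blocks V n)
    {R R' : ℕ → ℕ → ℕ → V} {k : ℕ}
    (h : ∀ j < k, ∀ r < K j + 1, ∀ l < T j + 1, R j r l = R' j r l) :
    D.arbcdRun Lip K T x0 R k = D.arbcdRun Lip K T x0 R' k := by
  induction k with
  | zero => rfl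
  | succ k ih =>
    simp only [arbcdRun, ih fun j hj => h j (by omega)]
    rw [bestOf_congr _ fun r hr => arbcdOutput_congr _ _ _ _ fun m hm =>
      h k (Nat.lt_succ_self k) r (by omega) m hm]

theorem arbcdRun_extendSamples [Nonempty V] (D : Data V κ n) (Lip : ℕ → V → ℝ) (K T : ℕ → ℕ)
    (x0 : Blocks V n) (R : ℕ → ℕ → ℕ → V) {j k : ℕ} (hj : j ≤ k) :
    D.arbcdRun Lip K T x0 (extendSamples (pastSamples K T k R)) j
      = D.arbcdRun Lip K T x0 R j :=
  D.arbcdRun_congr Lip K T x0 fun _ hi _ hr _ hl =>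
    extendSamples_pastSamples R (hi.trans_le hj) hr hl

theorem accepted_arbcdRun_extendSamples [Nonempty V] (D : Data V κ n) (Lip : ℕ → V → ℝ)
    (K T : ℕ → ℕ) (x0 : Blocks V n) (R : ℕ → ℕ → ℕ → V) {j k : ℕ} (hj : j < k) :
    D.Accepted (fun l =>
        (D.arbcdRun Lip K T x0 (extendSamples (pastSamples K T k R)) l).1) j ↔
      D.Accepted (fun l => (D.arbcdRun Lip K T x0 R l).1) j := by
  simp only [Accepted, ← arbcdRun_snd]
  rw [D.arbcdRun_extendSamples Lip K T x0 R hj.le, D.arbcdRun_extendSamples Lip K T x0 R hj]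

/-- The nodes `s` for which a call of ARBCD in outer iteration `k`, started at `x` with dual
vector `θ`, fails to achieve (a). -/
def BadCall [Nonempty V] (D : Data V κ n) (Lip : V → ℝ) (k T : ℕ)
    (x : Blocks V n) (θ : EuclideanSpace ℝ κ) (s : Fin (T + 1) → V) : Prop :=
  ¬ D.CondA k θ (arbcdOutput (fun i y => D.lam k * D.ρ i y) (D.smoothPart k θ) Lip x
    (extendSeq s) T)

theorem accepted_arbcdRun_of_not_badCall [Nonempty V] (D : Data V κ n) (Lip : ℕ → V → ℝ)
    (K T : ℕ → ℕ) (x0 : Blocks V n) (R : ℕ → ℕ → ℕ → V) {k r : ℕ} (hr : r < K k + 1)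
    (h : ¬ D.BadCall (Lip k) k (T k) (D.arbcdRun Lip K T x0 R k).1
      (D.arbcdRun Lip K T x0 R k).2 fun l => R k r l) :
    D.Accepted (fun l => (D.arbcdRun Lip K T x0 R l).1) k := by
  left
  rw [← arbcdRun_snd]
  obtain ⟨xs, hxs, hle⟩ := not_not.1 h
  refine ⟨xs, hxs, (sub_le_sub_right ?_ _).trans hle⟩
  rw [arbcdOutput_congr (idx' := R k r) _ _ _ _ fun m hm => by simp [extendSeq, hm]]
  exact bestOf_le _ (fun r => arbcdOutput _ _ _ _ (R k r) (T k)) (Nat.lt_succ_iff.1 hr)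

variable {Ω : Type*} [MeasurableSpace Ω] {μ : Measure Ω} {R : Ω → ℕ → ℕ → ℕ → V} [Nonempty V]

theorem measurable_arbcdRun (D : Data V κ n) (Lip : ℕ → V → ℝ) (K T : ℕ → ℕ)
    (x0 : Blocks V n) (hR : IsUniformSampling μ R) (k : ℕ) :
    Measurable fun ω => (D.arbcdRun Lip K T x0 (R ω) k).1 := by
  let : MeasurableSpace V := ⊤
  have hrun : (fun ω => (D.arbcdRun Lip K T x0 (R ω) k).1)
      = (fun h => (D.arbcdRun Lip K T x0 (extendSamples h) k).1) ∘
        fun ω => pastSamples K T k (R ω) :=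
    funext fun ω =>
      congrArg Prod.fst (D.arbcdRun_extendSamples Lip K T x0 (R ω) le_rfl).symm
  rw [hrun]
  exact Measurable.comp .of_discrete (measurable_pastSamples hR.measurable K T k)

theorem measurableSet_accepted_arbcdRun (D : Data V κ n) (Lip : ℕ → V → ℝ) (K T : ℕ → ℕ)
    (x0 : Blocks V n) (hR : IsUniformSampling μ R) (k : ℕ) :
    MeasurableSet {ω | D.Accepted (fun l => (D.arbcdRun Lip K T x0 (R ω) l).1) k} := by
  let : MeasurableSpace V := ⊤
  have hevent : {ω | D.Accepted (fun l => (D.arbcdRun Lip K T x0 (R ω) l).1) k}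
      = (fun ω => pastSamples K T (k + 1) (R ω)) ⁻¹'
        {h | D.Accepted (fun l => (D.arbcdRun Lip K T x0 (extendSamples h) l).1) k} :=
    Set.ext fun ω =>
      (D.accepted_arbcdRun_extendSamples Lip K T x0 (R ω) k.lt_succ_self).symm
  rw [hevent]
  exact measurable_pastSamples hR.measurable K T (k + 1) .of_discrete

open Classical in
theorem measureReal_not_accepted_arbcdRun_le [IsFiniteMeasure μ] (D : Data V κ n)
    (Lip : ℕ → V → ℝ) (K T : ℕ → ℕ) (x0 : Blocks V n) (hR : IsUniformSampling μ R) {k : ℕ}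
    (hcard : ∀ R : ℕ → ℕ → ℕ → V,
      (∀ j < k, D.Accepted (fun l => (D.arbcdRun Lip K T x0 R l).1) j) →
      2 * ((Finset.univ.filter (D.BadCall (Lip k) k (T k) (D.arbcdRun Lip K T x0 R k).1
          (D.arbcdRun Lip K T x0 R k).2)).card : ℝ) ≤ (Fintype.card V : ℝ) ^ (T k + 1)) :
    μ.real ({ω | ∀ j < k, D.Accepted (fun l => (D.arbcdRun Lip K T x0 (R ω) l).1) j} \
        {ω | D.Accepted (fun l => (D.arbcdRun Lip K T x0 (R ω) l).1) k})
      ≤ (1 / 2) ^ (K k + 1)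
        * μ.real {ω | ∀ j < k, D.Accepted (fun l => (D.arbcdRun Lip K T x0 (R ω) l).1) j} := by
  let : MeasurableSpace V := ⊤
  let run (h : samplePast K T k → V) := D.arbcdRun Lip K T x0 (extendSamples h)
  let good : Set (samplePast K T k → V) := {h | ∀ j < k, D.Accepted (fun l => (run h l).1) j}
  let bad (h : samplePast K T k → V) : Set (Fin (K k + 1) → Fin (T k + 1) → V) :=
    {s | ∀ r, D.BadCall (Lip k) k (T k) (run h k).1 (run h k).2 (s r)}
  have hgood : {ω | ∀ j < k, D.Accepted (fun l => (D.arbcdRun Lip K T x0 (R ω) l).1) j}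
      = {ω | pastSamples K T k (R ω) ∈ good} := by
    ext ω
    exact forall₂_congr fun j hj => (D.accepted_arbcdRun_extendSamples Lip K T x0 _ hj).symm
  have hblock : Function.Injective fun s : Fin (K k + 1) × Fin (T k + 1) =>
      ((k, s.1, s.2) : ℕ × ℕ × ℕ) := fun s t hst => by
    simp only [Prod.mk.injEq, true_and] at hst
    exact Prod.ext (Fin.ext hst.1) (Fin.ext hst.2)
  have hbad : ∀ h ∈ good, μ.real {ω | (fun (r : Fin (K k + 1)) (l : Fin (T k + 1)) => R ω k r l)
      ∈ bad h} ≤ (1 / 2) ^ (K k + 1) := fun h hh => by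
    simpa [bad] using measureReal_forall_mem_le_of_uniform
      (f := fun (r : Fin (K k + 1)) (l : Fin (T k + 1)) ω => R ω k r l)
      (fun _ _ => hR.measurable _ _ _) (hR.indep.precomp hblock) (fun _ _ => hR.uniform _ _ _)
      ((hcard (extendSamples h) hh).trans_eq (by rw [Fintype.card_fin]))
  rw [hgood]
  refine (measureReal_mono ?_).trans <| measureReal_mem_and_mem_le_of_indepFun
    (measurable_pastSamples hR.measurable K T k)
    (indepFun_pastSamples hR.measurable hR.indep K T k) hbad
  rintro ω ⟨hpast, hfail⟩
  refine ⟨hpast, fun r => by_contra fun hcall => hfail ?_⟩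
  refine D.accepted_arbcdRun_of_not_badCall Lip K T x0 (R ω) r.2 ?_
  rwa [← D.arbcdRun_extendSamples Lip K T x0 (R ω) le_rfl]

open Classical in
theorem asyncAccepted_arbcdRun [IsProbabilityMeasure μ] (D : Data V κ n)
    (Lip : ℕ → V → ℝ) (K T : ℕ → ℕ) (x0 : Blocks V n) {M : ℕ} {p : ℝ} (hp1 : p < 1)
    (hcard : ∀ k < M, ∀ R : ℕ → ℕ → ℕ → V,
      (∀ j < k, D.Accepted (fun l => (D.arbcdRun Lip K T x0 R l).1) j) →
      2 * ((Finset.univ.filter (D.BadCall (Lip k) k (T k) (D.arbcdRun Lip K T x0 R k).1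
          (D.arbcdRun Lip K T x0 R k).2)).card : ℝ) ≤ (Fintype.card V : ℝ) ^ (T k + 1))
    (hK : ∀ k < M, (1 / 2 : ℝ) ^ (K k + 1) ≤ 1 - (1 - p) ^ (1 / (M : ℝ)))
    (hR : IsUniformSampling μ R) :
    D.AsyncAccepted μ (fun k ω => (D.arbcdRun Lip K T x0 (R ω) k).1) M p := fun _ hk =>
  le_measureReal_cond_of_measureReal_sdiff_le (D.measurableSet_accepted_arbcdRun Lip K T x0 hR)
    (Real.rpow_pos_of_pos (by linarith) _) (fun k hk =>
      (D.measureReal_not_accepted_arbcdRun_le Lip K T x0 hR (hcard k hk)).trans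
        (mul_le_mul_of_nonneg_right (hK k hk) measureReal_nonneg)) hk

end Data

/-! ### Complexity -/

section Repetitions

theorem div_le_one_sub_rpow_one_div {M p : ℝ} (hM : 1 ≤ M) (hp1 : p ≤ 1) :
    p / M ≤ 1 - (1 - p) ^ (1 / M) := by
  have hbernoulli := rpow_one_add_le_one_add_mul_self (s := -p) (by linarith) (p := 1 / M)
    (by positivity) (div_le_one_of_le₀ hM (by linarith))
  rw [← sub_eq_add_neg] at hbernoulli
  have hdiv : 1 / M * -p = -(p / M) := by ring
  linarith

theorem exists_half_pow_le {M p : ℝ} (hM : 1 ≤ M) (hp0 : 0 < p) (hp1 : p < 1) :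
    ∃ K : ℕ, (1 / 2 : ℝ) ^ (K + 1) ≤ p / M ∧
      (K : ℝ) + 1 ≤ 2 + (Real.log M + Real.log (1 / p)) / Real.log 2 := by
  have hMp : 1 ≤ M / p := by rw [le_div_iff₀ hp0]; linarith
  refine ⟨⌈Real.logb 2 (M / p)⌉₊, ?_, ?_⟩
  · have hpow : M / p ≤ 2 ^ ⌈Real.logb 2 (M / p)⌉₊ := by
      rw [← Real.rpow_natCast, ← Real.logb_le_iff_le_rpow one_lt_two (by linarith)]
      exact Nat.le_ceil _
    refine (pow_le_pow_of_le_one (by norm_num) (by norm_num) (Nat.le_succ _)).trans ?_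
    rw [one_div, inv_pow, ← inv_div M p]
    exact inv_anti₀ (by linarith) hpow
  · have hceil := (Nat.ceil_lt_add_one (Real.logb_nonneg one_lt_two hMp)).le
    have hlogb : Real.logb 2 (M / p) = (Real.log M + Real.log (1 / p)) / Real.log 2 := by
      rw [Real.logb, Real.log_div (by linarith) hp0.ne', one_div, Real.log_inv, sub_eq_add_neg]
    linarith

theorem eventually_mul_add_le_sq (a b : ℝ) : ∀ᶠ y : ℝ in Filter.atTop, a * y + b ≤ y ^ 2 := by
  filter_upwards [Filter.eventually_ge_atTop (|a| + |b| + 1)] with y hy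
  nlinarith [le_abs_self a, le_abs_self b, abs_nonneg a, abs_nonneg b]

theorem tendsto_log_one_div_nhdsGT_zero :
    Filter.Tendsto (fun ε : ℝ => Real.log (1 / ε)) (nhdsWithin 0 (Set.Ioi 0)) Filter.atTop := by
  simp only [one_div]
  exact Real.tendsto_log_atTop.comp tendsto_inv_nhdsGT_zero

end Repetitions

namespace Data

variable {V κ : Type*} [Fintype V] [DecidableEq V] [Fintype κ] {n : ℕ}
  {G : SimpleGraph V} [DecidableRel G.Adj] {D : Data V κ n} {L : V → ℝ≥0} {τ : V → ℝ}

namespace IsAdmissible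

theorem outerIters_le (hD : D.IsAdmissible G L τ) {C ε : ℝ} (hε : 0 < ε) (hεC : ε ≤ C) :
    (D.outerIters C ε : ℝ) ≤ Real.logb (1 / D.c) (C / ε) + 1 := by
  have hlogb : 0 ≤ Real.logb (1 / D.c) (C / ε) :=
    Real.logb_nonneg (one_lt_one_div hD.c_pos hD.c_lt_one) ((one_le_div hε).2 hεC)
  rw [outerIters, Nat.cast_max, Nat.cast_one]
  exact max_le (by linarith) (Nat.ceil_lt_add_one hlogb).le

theorem eventually_log_outerIters_le (hD : D.IsAdmissible G L τ) {C : ℝ} (hC : 0 < C) :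
    ∀ᶠ ε : ℝ in nhdsWithin 0 (Set.Ioi 0),
      Real.log (D.outerIters C ε) ≤ 2 * Real.log (Real.log (1 / ε)) := by
  filter_upwards [self_mem_nhdsWithin, Ioc_mem_nhdsGT hC,
    tendsto_log_one_div_nhdsGT_zero.eventually (eventually_mul_add_le_sq
      (Real.log (1 / D.c))⁻¹ (Real.log C / Real.log (1 / D.c) + 1))] with ε hε hεC hsq
  have hM : (D.outerIters C ε : ℝ) ≤ Real.log (1 / ε) ^ 2 := by
    refine ((hD.outerIters_le hε hεC.2).trans_eq ?_).trans hsq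
    rw [Real.logb, Real.log_div hC.ne' (ne_of_gt hε), one_div ε, Real.log_inv]
    ring
  have hlog := Real.log_le_log (by exact_mod_cast D.one_le_outerIters C ε) hM
  rwa [Real.log_pow, Nat.cast_ofNat] at hlog

theorem sum_inv_pow_outerIters_le (hD : D.IsAdmissible G L τ) {C ε : ℝ} (hε : 0 < ε)
    (hεC : ε ≤ C) :
    ∑ k ∈ Finset.range (D.outerIters C ε), (1 / D.c) ^ k ≤ C / ε / (1 - D.c) := by
  have hc := hD.c_pos
  have hr : 1 < 1 / D.c := one_lt_one_div hc hD.c_lt_one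
  have hCε : 0 < C / ε := div_pos (hε.trans_le hεC) hε
  have hpow : (1 / D.c) ^ D.outerIters C ε ≤ C / ε * (1 / D.c) := by
    have hexp := Real.rpow_le_rpow_of_exponent_le hr.le (hD.outerIters_le hε hεC)
    rwa [Real.rpow_add (by positivity), Real.rpow_logb (by positivity) hr.ne' hCε,
      Real.rpow_one, Real.rpow_natCast] at hexp
  have hr_sub : 1 / D.c - 1 = (1 - D.c) / D.c := by field_simp
  have h1c : 0 < 1 - D.c := sub_pos.2 hD.c_lt_one
  rw [geom_sum_eq hr.ne', hr_sub]
  calc ((1 / D.c) ^ D.outerIters C ε - 1) / ((1 - D.c) / D.c)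
      ≤ C / ε * (1 / D.c) / ((1 - D.c) / D.c) := by gcongr; linarith
    _ = C / ε / (1 - D.c) := by field_simp

theorem exists_budget (hD : D.IsAdmissible G L τ) {C Q : ℝ} (hC : 0 < C) (hQ : 0 < Q) :
    ∃ B : ℝ, 0 < B ∧ ∀ᶠ ε : ℝ in nhdsWithin 0 (Set.Ioi 0), ∀ p : ℝ, 0 < p → p < 1 →
      ∃ K : ℕ, (1 / 2 : ℝ) ^ (K + 1) ≤ 1 - (1 - p) ^ (1 / (D.outerIters C ε : ℝ)) ∧
        ∀ T : ℕ → ℕ, (∀ k, (T k : ℝ) + 1 ≤ Q * (1 / D.c) ^ k) →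
        (∑ k ∈ Finset.range (D.outerIters C ε), (((K + 1) * (T k + 1) : ℕ) : ℝ)) ≤
          B * (1 / ε) * (Real.log (1 / p) + Real.log (Real.log (1 / ε))) := by
  have h1c : 0 < 1 - D.c := sub_pos.2 hD.c_lt_one
  have hlog2 : 0 < Real.log 2 := Real.log_pos one_lt_two
  refine ⟨(2 + 2 / Real.log 2) * (Q * (C / (1 - D.c))), by positivity, ?_⟩
  filter_upwards [Ioc_mem_nhdsGT hC, hD.eventually_log_outerIters_le hC,
    (Real.tendsto_log_atTop.comp tendsto_log_one_div_nhdsGT_zero).eventually_ge_atTop 1]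
    with ε hε hlogM hloglog p hp0 hp1
  rw [Function.comp_apply] at hloglog
  have hM : (1 : ℝ) ≤ D.outerIters C ε := by exact_mod_cast D.one_le_outerIters C ε
  obtain ⟨K, hhalf, hK⟩ := exists_half_pow_le hM hp0 hp1
  refine ⟨K, hhalf.trans (div_le_one_sub_rpow_one_div hM hp1.le), fun T hT => ?_⟩
  have hlogp : 0 ≤ Real.log (1 / p) := Real.log_nonneg (one_lt_one_div hp0 hp1).le
  have hcalls : (K : ℝ) + 1
      ≤ (2 + 2 / Real.log 2) * (Real.log (1 / p) + Real.log (Real.log (1 / ε))) := by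
    have hdiv : (Real.log (D.outerIters C ε) + Real.log (1 / p)) / Real.log 2
        ≤ 2 / Real.log 2 * (Real.log (1 / p) + Real.log (Real.log (1 / ε))) := by
      rw [div_mul_eq_mul_div]
      exact div_le_div_of_nonneg_right (by linarith) hlog2.le
    rw [add_mul]
    linarith
  have hsteps : ∑ k ∈ Finset.range (D.outerIters C ε), ((T k : ℝ) + 1)
      ≤ Q * (C / ε / (1 - D.c)) := by
    refine (Finset.sum_le_sum fun k _ => hT k).trans ?_
    rw [← Finset.mul_sum]
    exact mul_le_mul_of_nonneg_left (hD.sum_inv_pow_outerIters_le hε.1 hε.2) hQ.le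
  calc (∑ k ∈ Finset.range (D.outerIters C ε), (((K + 1) * (T k + 1) : ℕ) : ℝ))
      = ((K : ℝ) + 1) * ∑ k ∈ Finset.range (D.outerIters C ε), ((T k : ℝ) + 1) := by
        push_cast
        rw [Finset.mul_sum]
    _ ≤ ((2 + 2 / Real.log 2) * (Real.log (1 / p) + Real.log (Real.log (1 / ε))))
        * (Q * (C / ε / (1 - D.c))) :=
        mul_le_mul hcalls hsteps (Finset.sum_nonneg fun k _ => by positivity) (by positivity)
    _ = _ := by ring

theorem exists_subproblem_sub_le (hD : D.IsAdmissible G L τ) (U R : ℝ) :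
    ∃ H : ℝ, ∀ k θ (x w : Blocks V n), ‖θ‖ ≤ U → ‖x‖ ≤ R → ‖w‖ ≤ R →
      D.subproblem k θ x - D.subproblem k θ w ≤ H := by
  have hρ := hD.continuous_rho
  have hγ := hD.continuous_gamma
  obtain ⟨S, hS⟩ := (isCompact_closedBall (0 : Blocks V n) R).exists_bound_of_continuousOn
    (f := fun x : Blocks V n => ∑ i, D.ρ i (x i) + ∑ i, D.γ i (x i))
    (by fun_prop : Continuous _).continuousOn
  obtain ⟨S', hS'⟩ := (isCompact_closedBall (0 : Blocks V n) R).exists_bound_of_continuousOn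
    (f := D.mulA) D.continuous_mulA.continuousOn
  refine ⟨2 * (D.lam₁ * |S|) + 1 / 2 * (S' + D.lam₁ * U) ^ 2, fun k θ x w hθ hx hw => ?_⟩
  have hlam := hD.lam_pos k
  have hlam_le := hD.lam_le_lam₁ k
  have hcost (y : Blocks V n) (hy : ‖y‖ ≤ R) :
      |D.lam k * (∑ i, D.ρ i (y i) + ∑ i, D.γ i (y i))| ≤ D.lam₁ * |S| := by
    rw [abs_mul, abs_of_pos hlam]
    exact mul_le_mul hlam_le ((hS y (mem_closedBall_zero_iff.2 hy)).trans (le_abs_self S))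
      (abs_nonneg _) hD.lam₁_pos.le
  have hresidual : ‖D.mulA x - D.lam k • θ‖ ≤ S' + D.lam₁ * U := by
    refine (norm_sub_le _ _).trans (add_le_add (hS' x (mem_closedBall_zero_iff.2 hx)) ?_)
    rw [norm_smul, Real.norm_of_nonneg hlam.le]
    exact mul_le_mul hlam_le hθ (norm_nonneg _) hD.lam₁_pos.le
  have hpenalty := pow_le_pow_left₀ (norm_nonneg _) hresidual 2
  simp only [subproblem, smoothPart]
  linarith [(abs_le.1 (hcost x hx)).2, (abs_le.1 (hcost w hw)).1,
    sq_nonneg ‖D.mulA w - D.lam k • θ‖]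

theorem sum_weight_mul_sq_le (hD : D.IsAdmissible G L τ) (k : ℕ) {R : ℝ} {x w : Blocks V n}
    (hx : ‖x‖ ≤ R) (hw : ‖w‖ ≤ R) :
    ∑ i, (D.lam k * L i + G.degree i) / 2 * ‖x i - w i‖ ^ 2
      ≤ ∑ i, (D.lam₁ * L i + G.degree i) / 2 * (2 * R) ^ 2 := by
  have hlam := hD.lam₁_pos
  have hlam_le := hD.lam_le_lam₁ k
  refine Finset.sum_le_sum fun i _ => ?_
  have hdist : ‖x i - w i‖ ≤ 2 * R := by
    linarith [norm_sub_le (x i) (w i), (norm_le_pi_norm x i).trans hx,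
      (norm_le_pi_norm w i).trans hw]
  gcongr

theorem exists_initial_gap_bound (hD : D.IsAdmissible G L τ) (x0 : Blocks V n) :
    ∃ H : ℝ, 0 < H ∧ ∀ (x : ℕ → Blocks V n) (k : ℕ), x 0 = x0 → (∀ j < k, D.Accepted x j) →
      ∀ xs, IsMinOn (D.subproblem k (D.dual x k)) Set.univ xs →
        2 * (D.subproblem k (D.dual x k) (x k) - D.subproblem k (D.dual x k) xs
          + ∑ i, (D.lam k * L i + G.degree i) / 2 * ‖x k i - xs i‖ ^ 2) ≤ H := by
  obtain ⟨U, hU⟩ := hD.exists_dual_bound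
  obtain ⟨R, hR0, hR⟩ := hD.exists_iterate_bound U
  obtain ⟨H, hH⟩ := hD.exists_subproblem_sub_le U (max R ‖x0‖)
  refine ⟨max 1 (2 * (H + ∑ i, (D.lam₁ * L i + G.degree i) / 2 * (2 * max R ‖x0‖) ^ 2)),
    by positivity, fun x k hx0 hacc xs hxs => le_max_of_le_right ?_⟩
  have hnear : ∀ j < k, D.NearMin j (D.dual x j) (x (j + 1)) := fun j hj =>
    hD.nearMin_of_accepted (hacc j hj)
  have hbound (j : ℕ) (hj : j ≤ k) (w : Blocks V n) (hw : D.NearMin j (D.dual x j) w) :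
      ‖w‖ ≤ max R ‖x0‖ :=
    ((pi_norm_le_iff_of_nonneg hR0).2 <|
      hR j _ w (hU x j fun i hi => hnear i (hi.trans_le hj)) hw).trans (le_max_left _ _)
  have hx : ‖x k‖ ≤ max R ‖x0‖ := by
    rcases k with _ | k
    · exact hx0 ▸ le_max_right _ _
    · exact hbound k k.le_succ _ (hnear k k.lt_succ_self)
  have hxs_norm : ‖xs‖ ≤ max R ‖x0‖ := hbound k le_rfl xs <|
    hD.nearMin_of_condA ⟨xs, hxs, by rw [sub_self]; exact (hD.alpha_pos k).le⟩
  linarith [hH k _ _ _ (hU x k hnear) hx hxs_norm, hD.sum_weight_mul_sq_le k hx hxs_norm]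

theorem le_stepSize_sq_mul_alpha (hD : D.IsAdmissible G L τ) {N H : ℝ} (hN : 0 < N) (hH : 0 ≤ H)
    {k T : ℕ} (hT : 2 * N * √(H / D.alpha₁) * (1 / D.c) ^ k ≤ T) :
    H ≤ stepSize N T ^ 2 * D.alpha k := by
  have hα := hD.alpha₁_pos
  have hc := hD.c_pos
  have hroot : √(H / D.alpha₁) * (1 / D.c) ^ k ≤ stepSize N T := by
    refine le_trans ?_ (one_add_div_le_stepSize hN T)
    have hdiv : √(H / D.alpha₁) * (1 / D.c) ^ k ≤ T / (2 * N) := by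
      rw [le_div_iff₀ (by positivity)]
      linarith
    linarith
  calc H = (√(H / D.alpha₁) * (1 / D.c) ^ k) ^ 2 * D.alpha k := by
        rw [mul_pow, Real.sq_sqrt (by positivity), alpha, ← pow_mul, ← pow_mul, one_div,
          inv_pow, mul_comm 2 k]
        field_simp
    _ ≤ stepSize N T ^ 2 * D.alpha k :=
        mul_le_mul_of_nonneg_right (pow_le_pow_left₀ (by positivity) hroot 2)
          (hD.alpha_pos k).le

open Classical in
theorem two_mul_card_badCall_le [Nontrivial V] (hD : D.IsAdmissible G L τ) {k T : ℕ}
    {x xs : Blocks V n} {θ : EuclideanSpace ℝ κ} (hxs : IsMinOn (D.subproblem k θ) Set.univ xs)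
    (hT : 2 * (D.subproblem k θ x - D.subproblem k θ xs
        + ∑ i, (D.lam k * L i + G.degree i) / 2 * ‖x i - xs i‖ ^ 2)
      ≤ stepSize (Fintype.card V) T ^ 2 * D.alpha k) :
    2 * ((Finset.univ.filter
      (D.BadCall (fun i => D.lam k * L i + G.degree i) k T x θ)).card : ℝ)
        ≤ (Fintype.card V : ℝ) ^ (T + 1) := by
  have hhalf := two_mul_card_not_optimal_le (hD.isCompositeProblem k θ) (z0 := x) (w := xs)
    (hD.alpha_pos k) (D.subproblem_eq_composite k θ ▸ hxs)
    (by rw [← subproblem_eq_composite]; exact hT)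
  refine le_trans (mul_le_mul_of_nonneg_left (Nat.cast_le.2 ?_) two_pos.le) hhalf
  refine Finset.card_le_card fun s hs => ?_
  simp only [Finset.mem_filter, Finset.mem_univ, true_and, ← subproblem_eq_composite] at hs ⊢
  exact lt_of_not_ge fun hle => hs ⟨xs, hxs, hle⟩

theorem exists_arbcd_complexity [Nontrivial V] (hD : D.IsAdmissible G L τ) {C : ℝ}
    (hC : 0 < C) (x0 : Blocks V n) :
    ∃ B ε₀ : ℝ, 0 < B ∧ 0 < ε₀ ∧ ∀ ε : ℝ, 0 < ε → ε < ε₀ → ∀ p : ℝ, 0 < p → p < 1 →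
      ∃ K T : ℕ → ℕ,
        (∑ k ∈ Finset.range (D.outerIters C ε), (((K k + 1) * (T k + 1) : ℕ) : ℝ)) ≤
          B * (1 / ε) * (Real.log (1 / p) + Real.log (Real.log (1 / ε))) ∧
        ∀ {Ω : Type*} [MeasurableSpace Ω] (μ : Measure Ω) [IsProbabilityMeasure μ]
          (R : Ω → ℕ → ℕ → ℕ → V), IsUniformSampling μ R →
          D.AsyncAccepted μ (fun k ω => (D.arbcdRun (fun k i => D.lam k * L i + G.degree i)
            K T x0 (R ω) k).1) (D.outerIters C ε) p := by
  obtain ⟨H, hH, hgap⟩ := hD.exists_initial_gap_bound x0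
  have hN : (0 : ℝ) < Fintype.card V := by exact_mod_cast Fintype.card_pos
  set Q : ℝ := 2 * Fintype.card V * √(H / D.alpha₁)
  obtain ⟨B, hB, hbudget⟩ := hD.exists_budget hC (by positivity : 0 < Q + 2)
  obtain ⟨ε₀, hε₀, hsmall⟩ := mem_nhdsGT_iff_exists_Ioo_subset.1 hbudget
  refine ⟨B, ε₀, hB, hε₀, fun ε hε hεlt p hp0 hp1 => ?_⟩
  obtain ⟨K, hK, hsum⟩ := hsmall ⟨hε, hεlt⟩ p hp0 hp1
  let T (k : ℕ) : ℕ := ⌈Q * (1 / D.c) ^ k⌉₊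
  refine ⟨fun _ => K, T, hsum T fun k => ?_, fun {Ω} _ μ _ R hR => ?_⟩
  · have hpow : 1 ≤ (1 / D.c) ^ k := one_le_pow₀ (one_lt_one_div hD.c_pos hD.c_lt_one).le
    have hceil := (Nat.ceil_lt_add_one (by positivity : 0 ≤ Q * (1 / D.c) ^ k)).le
    linarith
  · refine D.asyncAccepted_arbcdRun _ (fun _ => K) T x0 hp1 (fun k _ R' hacc => ?_)
      (fun _ _ => hK) hR
    obtain ⟨xs, hxs⟩ := hD.exists_isMinOn_subproblem k
      (D.arbcdRun (fun k i => D.lam k * L i + G.degree i) (fun _ => K) T x0 R' k).2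
    refine hD.two_mul_card_badCall_le hxs <| le_trans ?_ <|
      hD.le_stepSize_sq_mul_alpha hN hH.le (Nat.le_ceil _)
    rw [arbcdRun_snd] at hxs ⊢
    exact hgap _ k rfl hacc xs hxs

end IsAdmissible

end Data

end AsyncDFAL

theorem mainTheorem6 {V κ : Type*} [Fintype V] [DecidableEq V] [Nontrivial V] [Fintype κ] {n : ℕ}
    (G : SimpleGraph V) [DecidableRel G.Adj] (hG : G.Connected)
    (D : AsyncDFAL.Data V κ n) (L : V → ℝ≥0) (τ : V → ℝ)
    (hγ : ∀ i, AsyncDFAL.IsSmoothTerm (D.γ i) (L i))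
    (hρ : ∀ i, AsyncDFAL.IsNonsmoothTerm (D.ρ i) (τ i))
    (hA : D.Aᵀ * D.A = G.lapMatrix ℝ ⊗ₖ (1 : Matrix (Fin n) (Fin n) ℝ))
    (hc₀ : 0 < D.c) (hc₁ : D.c < 1) (hlam : 0 < D.lam₁) (halpha : 0 < D.alpha₁)
    (hxi : 0 < D.xi₁) (hxi_lam : ∀ i, D.xi₁ / D.lam₁ < τ i) :
    ∃ Cbar : ℝ, 0 < Cbar ∧
      -- every asynchronous variant is `ε`-optimal and `ε`-feasible after `N(ε)` outer iterations
      (∀ ε : ℝ, 0 < ε → ∀ p : ℝ, 0 < p → p < 1 →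
        ∀ (Ω : Type*) [MeasurableSpace Ω] (μ : Measure Ω) [IsProbabilityMeasure μ]
          (x : ℕ → Ω → AsyncDFAL.Blocks V n), (∀ k, Measurable (x k)) →
          D.AsyncAccepted μ x (D.outerIters Cbar ε) p →
          1 - p ≤ μ.real {ω | D.EpsOptimal ε (x (D.outerIters Cbar ε) ω) ∧
            AsyncDFAL.EpsFeasible G ε (x (D.outerIters Cbar ε) ω)}) ∧
      -- the ARBCD implementation and its total number of ARBCD iterations
      (∀ x0 : AsyncDFAL.Blocks V n, ∃ M ε₀ : ℝ, 0 < M ∧ 0 < ε₀ ∧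
        ∀ ε : ℝ, 0 < ε → ε < ε₀ → ∀ p : ℝ, 0 < p → p < 1 →
        ∃ K T : ℕ → ℕ,
          (∑ k ∈ Finset.range (D.outerIters Cbar ε), (((K k + 1) * (T k + 1) : ℕ) : ℝ)) ≤
            M * (1 / ε) * (Real.log (1 / p) + Real.log (Real.log (1 / ε))) ∧
          ∀ (Ω : Type*) [MeasurableSpace Ω] (μ : Measure Ω) [IsProbabilityMeasure μ]
            (R : Ω → ℕ → ℕ → ℕ → V), AsyncDFAL.IsUniformSampling μ R →
            ∀ x : ℕ → Ω → AsyncDFAL.Blocks V n,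
              (∀ k ω, x k ω =
                (D.arbcdRun (fun k i => D.lam k * L i + G.degree i) K T x0 (R ω) k).1) →
              D.AsyncAccepted μ x (D.outerIters Cbar ε) p ∧
              1 - p ≤ μ.real {ω | D.EpsOptimal ε (x (D.outerIters Cbar ε) ω) ∧
                AsyncDFAL.EpsFeasible G ε (x (D.outerIters Cbar ε) ω)}) := by
  have hD : D.IsAdmissible G L τ := ⟨hG, hγ, hρ, hA, hc₀, hc₁, hlam, halpha, hxi, hxi_lam⟩
  obtain ⟨C, hC, hrate⟩ := hD.exists_rate
  refine ⟨C / D.c, by positivity, fun ε hε p _ hp1 Ω _ μ _ x hx hacc =>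
    hD.async_guarantee hC hrate hε hp1 μ hx hacc, fun x0 => ?_⟩
  obtain ⟨B, ε₀, hB, hε₀, hcomplexity⟩ :=
    hD.exists_arbcd_complexity (by positivity : 0 < C / D.c) x0
  refine ⟨B, ε₀, hB, hε₀, fun ε hε hεlt p hp0 hp1 => ?_⟩
  obtain ⟨K, T, hsum, hacc⟩ := hcomplexity ε hε hεlt p hp0 hp1
  refine ⟨K, T, hsum, fun Ω _ μ _ R hR x hx => ?_⟩
  have hxrun : x = fun k ω => (D.arbcdRun (fun k i => D.lam k * L i + G.degree i)
      K T x0 (R ω) k).1 := funext fun k => funext (hx k)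
  have hmeas : ∀ k, Measurable (x k) := hxrun ▸ D.measurable_arbcdRun _ K T x0 hR
  have hacc_x : D.AsyncAccepted μ x (D.outerIters (C / D.c) ε) p := hxrun ▸ hacc μ R hR
  exact ⟨hacc_x, hD.async_guarantee hC hrate hε hp1 μ hmeas hacc_x⟩
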